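/- **Theorem (discrete energy dissipation equality).** Let $d\in\{1,2,3\}$, let $\Omega\subset\mathbb R^d$ be a bounded open set that equals the interior of its closure (for instance a bounded Lipschitz domain), and let $\mathcal T$ be a conforming triangulation of $\Omega$: a finite family of pairwise distinct open nondegenerate simplices, such that the intersection of any two closed elements is a full subsimplex (possibly empty) of both, and the closed elements cover exactly $\overline\Omega$. Let $\mathcal E$ be the set of facets common to two elements and not contained in $\partial\Omega$, let $h(x)$ be the largest diameter of an element whose closure contains $x$, and let $n_K$ be the outward unit normal of $K\in\mathcal T$. On an interface of $K_1,K_2$ put $\{u\}=\tfrac12(u|_{K_1}+u|_{K_2})$ (for scalars, vectors, matrices), $[u]=u|_{K_1}n_{K_1}+u|_{K_2}n_{K_2}$ for scalar $u$, $[v]=v|_{K_1}\cdot n_{K_1}+v|_{K_2}\cdot n_{K_2}$ and $[v]_\otimes=v|_{K_1}\otimes n_{K_1}+v|_{K_2}\otimes n_{K_2}$ for vector $v$; on facets in $\partial\Omega$ put $\{u\}=u$, $[v]_\otimes=v\otimes n$. Differential operators act elementwise, integrals over $\Omega$ are sums of integrals over the elements. Let $\rho_1,\rho_2,\gamma,m_r,m_j,\eta>0$,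 $\sigma\in\mathbb R$, $W\in C^1(\mathbb R)$, $c_\pm=\frac1{\rho_1}\pm\frac1{\rho_2}$ and $\rho(\phi)=\frac12[\rho_1(1+\phi)+\rho_2(1-\phi)]$. For $p\ge0$ let $\mathbb V$ be the space of piecewise polynomials of degree at most $p$ on $\mathcal T$ (no continuity between elements), $\mathbb V_0^d$ the set of $v\in\mathbb V^d$ with $v=0$ on $\partial\Omega$, and $\mathbb V_n$ the set of $q\in\mathbb V^d$ with $q\cdot n=0$ on $\partial\Omega$. Define $$\mathcal A_1(a,\chi)=-\int_\Omega\nabla a\cdot\nabla\chi+\int_{\mathcal E}\Big(\{\nabla\chi\}\cdot[a]+[\chi]\cdot\{\nabla a\}-\tfrac{\sigma}{h}[a]\cdot[\chi]\Big),$$ $$\mathcal A_2(v,\xi)=-\int_\Omega Dv:D\xi+\int_{\mathcal E\cup\partial\Omega}\Big(\{D\xi\}:[v]_\otimes+\{Dv\}:[\xi]_\otimes-\tfrac{\sigma}{h}[v]_\otimes:[\xi]_\otimes\Big).$$ Let $\phi_h\in C^1([0,T),\mathbb V)$, $v_h\in C^1([0,T),\mathbb V_0^d)$, $\lambda_h,a_h,b_h\in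 C^0([0,T),\mathbb V)$, $q_h\in C^0([0,T),\mathbb V_n)$ satisfy, for all $t\in[0,T)$ and all $(\chi,\xi,\zeta,\psi,\upsilon,\tau)\in\mathbb V\times\mathbb V_0^d\times\mathbb V\times\mathbb V\times\mathbb V\times\mathbb V_n$, $$0=\int_\Omega(\partial_t\phi_h+\operatorname{div}(\phi_hv_h)+c_+m_ra_h)\chi-c_+m_j\mathcal A_1(a_h,\chi)-\int_{\mathcal E}[\phi_hv_h]\{\chi\},$$ $$\begin{aligned}0={}&\int_\Omega\rho(\phi_h)\partial_tv_h\cdot\xi+\rho(\phi_h)((v_h\cdot\nabla)v_h)\cdot\xi-\tfrac12\rho(\phi_h)\nabla(|v_h|^2)\cdot\xi+\nabla b_h\cdot\xi+\tfrac{\phi_h}{c_+}\nabla(a_h-c_-b_h)\cdot\xi-\eta\mathcal A_2(v_h,\xi)\\&+\int_{\mathcal E}-(\{\xi\}\otimes\{\rho(\phi_h)v_h\}):[v_h]_\otimes+\tfrac12[|v_h|^2]\cdot\{\rho(\phi_h)\xi\}-[b_h]\cdot\{\xi\}-\tfrac1{c_+}[a_h-c_-b_h]\cdot\{\phi_h\xi\},\end{aligned}$$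 $$0=\int_\Omega\operatorname{div}(v_h)\zeta-\tfrac{c_-}{c_+}\partial_t\phi_h\,\zeta-\tfrac{c_-}{c_+}\operatorname{div}(\phi_hv_h)\zeta+\int_{\mathcal E}\big[\tfrac{c_-}{c_+}\phi_hv_h-v_h\big]\{\zeta\},$$ $$0=\int_\Omega(a_h-c_+W'(\phi_h)-c_-\lambda_h)\psi+c_+\gamma\operatorname{div}(q_h)\psi-c_+\gamma\int_{\mathcal E}[q_h]\{\psi\},$$ $$0=\int_\Omega\big(b_h-\lambda_h-\tfrac{\rho_1+\rho_2}4|v_h|^2\big)\upsilon,\qquad 0=\int_\Omega q_h\cdot\tau-\nabla\phi_h\cdot\tau+\int_{\mathcal E}[\phi_h]\cdot\{\tau\}.$$ Then for every $t\in[0,T)$ the energy below is differentiable in time (one-sidedly at $t=0$) and $$\frac{d}{dt}\int_\Omega\Big(W(\phi_h)+\tfrac12\rho(\phi_h)|v_h|^2+\tfrac12\gamma|q_h|^2\Big)=-\int_\Omega m_r|a_h|^2+m_j\,\mathcal A_1(a_h,a_h)+\eta\,\mathcal A_2(v_h,v_h).$$ -/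

import Mathlib

open MeasureTheory Set

noncomputable section

namespace QuasiIncompressible

/-- Euclidean `d`-space. -/
abbrev Pt (d : ℕ) : Type := EuclideanSpace ℝ (Fin d)

/-- Tensor product `a ⊗ b` of vectors. -/
def tensor {d : ℕ} (a b : Pt d) : Matrix (Fin d) (Fin d) ℝ := Matrix.of fun k l => a k * b l

/-! ### Physical data -/

/-- Constants and potential of the model. The penalty parameter `σ` may be any real number. -/
structure Model where
  ρ₁ : ℝ
  ρ₂ : ℝ
  γ : ℝ
  m_r : ℝ
  m_j : ℝ
  η : ℝ
  σ : ℝ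
  W : ℝ → ℝ
  ρ₁_pos : 0 < ρ₁
  ρ₂_pos : 0 < ρ₂
  γ_pos : 0 < γ
  m_r_pos : 0 < m_r
  m_j_pos : 0 < m_j
  η_pos : 0 < η
  W_contDiff : ContDiff ℝ 1 W

namespace Model

variable (P : Model)

/-- `c₊ = 1/ρ₁ + 1/ρ₂`. -/
def cPlus : ℝ := 1 / P.ρ₁ + 1 / P.ρ₂

/-- `c₋ = 1/ρ₁ - 1/ρ₂`. -/
def cMinus : ℝ := 1 / P.ρ₁ - 1 / P.ρ₂

/-- Total density of the mixture, as a function of the phase fraction. -/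
def rho (s : ℝ) : ℝ := (1 / 2) * (P.ρ₁ * (1 + s) + P.ρ₂ * (1 - s))

end Model

/-! ### Triangulations -/

/-- A conforming triangulation of `Ω` by `N` nondegenerate `d`-simplices. The open elements are the
sets `(elem i).interior`, their closures the sets `(elem i).closedInterior`. -/
structure Triangulation (d : ℕ) (Ω : Set (Pt d)) (N : ℕ) where
  elem : Fin N → Affine.Simplex ℝ (Pt d) d
  /-- The elements are listed without repetition. -/
  elem_injective : Function.Injective fun i => (elem i).interior
  /-- Two closed elements meet in a full subsimplex (possibly empty) of both. -/
  conforming : ∀ i j, ∃ S S' : Set (Fin (d + 1)),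
    (elem i).closedInterior ∩ (elem j).closedInterior = convexHull ℝ ((elem i).points '' S) ∧
    (elem i).closedInterior ∩ (elem j).closedInterior = convexHull ℝ ((elem j).points '' S')
  /-- The closed elements cover the closure of `Ω`. -/
  iUnion_eq : ⋃ i, (elem i).closedInterior = closure Ω

namespace Triangulation

variable {d : ℕ} [NeZero d] {Ω : Set (Pt d)} {N : ℕ} (M : Triangulation d Ω N)

/-- The closed facet of element `i` opposite to its vertex number `k`. -/
def facet (i : Fin N) (k : Fin (d + 1)) : Set (Pt d) :=
  ((M.elem i).faceOpposite k).closedInterior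

/-- The outward unit normal of element `i` on its facet opposite to vertex number `k`: the
normalized vector from that vertex to its orthogonal projection onto the facet. -/
def normal (i : Fin N) (k : Fin (d + 1)) : Pt d :=
  ‖(M.elem i).altitudeFoot k - (M.elem i).points k‖⁻¹ •
    ((M.elem i).altitudeFoot k - (M.elem i).points k)

/-- A common interface is recorded as `((i, k), (j, l))`: it is facet `k` of `K₁ = elem i` and
facet `l` of `K₂ = elem j`. -/
abbrev Side (d N : ℕ) : Type := (Fin N × Fin (d + 1)) × (Fin N × Fin (d + 1))

open Classical in
/-- The interior skeleton `ℰ`: the interfaces common to two elements (each listed once, by `i < j`)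
which do not lie on `∂Ω`. -/
def skeleton : Finset (Side d N) :=
  Finset.univ.filter fun e => e.1.1 < e.2.1 ∧ M.facet e.1.1 e.1.2 = M.facet e.2.1 e.2.2 ∧
    ¬ M.facet e.1.1 e.1.2 ⊆ frontier Ω

open Classical in
/-- The element facets which lie on `∂Ω`. -/
def boundaryFacets : Finset (Fin N × Fin (d + 1)) :=
  Finset.univ.filter fun f => M.facet f.1 f.2 ⊆ frontier Ω

/-- The mesh size function: the largest diameter of an element whose closure contains `x`. -/
def meshSize (x : Pt d) : ℝ :=
  sSup {r | ∃ i, x ∈ (M.elem i).closedInterior ∧ r = Metric.diam (M.elem i).interior}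

/-! ### Integrals of broken functions

A broken function has one branch per element; the trace of `u` on a facet of element `i` is the
value of its branch `u i`. -/

/-- `∫_Ω g` for a function given elementwise. -/
def intDomain (g : Fin N → Pt d → ℝ) : ℝ :=
  ∑ i, ∫ x in (M.elem i).interior, g i x

/-- `∫_ℰ g`, with respect to the `(d-1)`-dimensional surface measure. -/
def intSkeleton (g : Side d N → Pt d → ℝ) : ℝ :=
  ∑ e ∈ M.skeleton, ∫ x in M.facet e.1.1 e.1.2, g e x ∂μHE[d - 1]

/-- `∫_{∂Ω} g`, with respect to the `(d-1)`-dimensional surface measure. -/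
def intBoundary (g : Fin N × Fin (d + 1) → Pt d → ℝ) : ℝ :=
  ∑ f ∈ M.boundaryFacets, ∫ x in M.facet f.1 f.2, g f x ∂μHE[d - 1]

/-! ### Jumps and averages -/

/-- Average `½ (u|_{K₁} + u|_{K₂})` of a scalar, vector or matrix valued broken function. -/
def avg {V : Type*} [AddCommGroup V] [Module ℝ V] (u : Fin N → Pt d → V) (e : Side d N)
    (x : Pt d) : V :=
  (1 / 2 : ℝ) • (u e.1.1 x + u e.2.1 x)

/-- Jump `u|_{K₁} n_{K₁} + u|_{K₂} n_{K₂}` of a scalar function. -/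
def jump (u : Fin N → Pt d → ℝ) (e : Side d N) (x : Pt d) : Pt d :=
  u e.1.1 x • M.normal e.1.1 e.1.2 + u e.2.1 x • M.normal e.2.1 e.2.2

/-- Jump `v|_{K₁} · n_{K₁} + v|_{K₂} · n_{K₂}` of a vector function. -/
def vjump (v : Fin N → Pt d → Pt d) (e : Side d N) (x : Pt d) : ℝ :=
  inner ℝ (v e.1.1 x) (M.normal e.1.1 e.1.2) + inner ℝ (v e.2.1 x) (M.normal e.2.1 e.2.2)

/-- Tensor jump `v|_{K₁} ⊗ n_{K₁} + v|_{K₂} ⊗ n_{K₂}` of a vector function. -/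
def tjump (v : Fin N → Pt d → Pt d) (e : Side d N) (x : Pt d) : Matrix (Fin d) (Fin d) ℝ :=
  tensor (v e.1.1 x) (M.normal e.1.1 e.1.2) +
    tensor (v e.2.1 x) (M.normal e.2.1 e.2.2)

/-- Tensor jump `v ⊗ n` on a boundary facet. -/
def tjumpBdry (v : Fin N → Pt d → Pt d) (f : Fin N × Fin (d + 1)) (x : Pt d) :
    Matrix (Fin d) (Fin d) ℝ :=
  tensor (v f.1 x) (M.normal f.1 f.2)

end Triangulation

/-! ### Elementwise differential operators -/

section Operators

variable {d : ℕ} {N : ℕ}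

/-- Elementwise gradient. -/
def bgrad (u : Fin N → Pt d → ℝ) (i : Fin N) (x : Pt d) : Pt d := gradient (u i) x

/-- Elementwise Jacobian, `(D v)_{kl} = ∂_l v_k`. -/
def bjac (v : Fin N → Pt d → Pt d) (i : Fin N) (x : Pt d) : Matrix (Fin d) (Fin d) ℝ :=
  Matrix.of fun k l => fderiv ℝ (v i) x (EuclideanSpace.single l 1) k

/-- Elementwise divergence. -/
def bdiv (v : Fin N → Pt d → Pt d) (i : Fin N) (x : Pt d) : ℝ := (bjac v i x).trace

/-- Frobenius inner product `A : B`. -/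
def frob (A B : Matrix (Fin d) (Fin d) ℝ) : ℝ := ∑ k, ∑ l, A k l * B k l

end Operators

/-! ### Finite element spaces -/

/-- Exponents of the monomials of total degree at most `p` in `d` variables. -/
abbrev Expo (d p : ℕ) : Type := {α : Fin d → Fin (p + 1) // ∑ k, (α k : ℕ) ≤ p}

/-- The space `𝕍 = ℙ_p(𝒯)` of discontinuous piecewise polynomials of total degree at most `p`,
in coordinates: for each element, the coefficients in the monomial basis. It carries the norm of
this finite dimensional space (all norms being equivalent). -/
abbrev FE (d N p : ℕ) : Type := Fin N → Expo d p → ℝ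

/-- The vector valued space `𝕍^d`, componentwise. -/
abbrev VFE (d N p : ℕ) : Type := Fin d → FE d N p

section FESpaces

variable {d N p : ℕ}

/-- The piecewise polynomial with the given coefficients. -/
def FE.fn (u : FE d N p) (i : Fin N) (x : Pt d) : ℝ :=
  ∑ α : Expo d p, u i α * ∏ k, x k ^ (α.1 k : ℕ)

/-- The piecewise polynomial vector field with the given coefficients. -/
def VFE.fn (v : VFE d N p) (i : Fin N) (x : Pt d) : Pt d :=
  WithLp.toLp 2 fun k => FE.fn (v k) i x

variable [NeZero d] {Ω : Set (Pt d)} (M : Triangulation d Ω N)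

/-- `𝕍₀^d`: the vector fields in `𝕍^d` whose components have zero trace on `∂Ω`. -/
def feZero (p : ℕ) : Set (VFE d N p) :=
  {v | ∀ f ∈ M.boundaryFacets, ∀ x ∈ M.facet f.1 f.2, VFE.fn v f.1 x = 0}

/-- `𝕍_n`: the vector fields in `𝕍^d` with zero normal trace on `∂Ω`. -/
def feNormal (p : ℕ) : Set (VFE d N p) :=
  {q | ∀ f ∈ M.boundaryFacets, ∀ x ∈ M.facet f.1 f.2,
    inner ℝ (VFE.fn q f.1 x) (M.normal f.1 f.2) = 0}

end FESpaces

/-! ### The semidiscrete scheme -/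

section Scheme

open Triangulation

variable {d N p : ℕ} [NeZero d] {Ω : Set (Pt d)} (M : Triangulation d Ω N) (P : Model)

/-- Symmetric interior penalty form `𝒜₁` for the scalar Laplacian (Neumann condition). -/
def formA1 (a χ : Fin N → Pt d → ℝ) : ℝ :=
  - M.intDomain (fun i x => inner ℝ (bgrad a i x) (bgrad χ i x))
  + M.intSkeleton (fun e x => inner ℝ (avg (bgrad χ) e x) (M.jump a e x))
  + M.intSkeleton (fun e x => inner ℝ (M.jump χ e x) (avg (bgrad a) e x)
      - P.σ / M.meshSize x * inner ℝ (M.jump a e x) (M.jump χ e x))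

/-- Symmetric interior penalty form `𝒜₂` for the vector Laplacian (Dirichlet condition). -/
def formA2 (v ξ : Fin N → Pt d → Pt d) : ℝ :=
  - M.intDomain (fun i x => frob (bjac v i x) (bjac ξ i x))
  + (M.intSkeleton (fun e x => frob (avg (bjac ξ) e x) (M.tjump v e x))
    + M.intBoundary (fun f x => frob (bjac ξ f.1 x) (M.tjumpBdry v f x)))
  + (M.intSkeleton (fun e x => frob (avg (bjac v) e x) (M.tjump ξ e x)
        - P.σ / M.meshSize x * frob (M.tjump v e x) (M.tjump ξ e x))
    + M.intBoundary (fun f x => frob (bjac v f.1 x) (M.tjumpBdry ξ f x)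
        - P.σ / M.meshSize x * frob (M.tjumpBdry v f x) (M.tjumpBdry ξ f x)))

/-- First equation, tested with `χ`; `φ'` stands for `∂_t φ`. -/
def Eq1 (φ φ' : Fin N → Pt d → ℝ) (v : Fin N → Pt d → Pt d) (a χ : Fin N → Pt d → ℝ) : Prop :=
  0 = M.intDomain (fun i x =>
        (φ' i x + bdiv (fun j y => φ j y • v j y) i x + P.cPlus * P.m_r * a i x) * χ i x)
    - P.cPlus * P.m_j * formA1 M P a χ
    - M.intSkeleton (fun e x => M.vjump (fun j y => φ j y • v j y) e x * avg χ e x)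

/-- Second equation, tested with `ξ`; `v'` stands for `∂_t v`. -/
def Eq2 (φ : Fin N → Pt d → ℝ) (v v' : Fin N → Pt d → Pt d) (a b : Fin N → Pt d → ℝ)
    (ξ : Fin N → Pt d → Pt d) : Prop :=
  0 = M.intDomain (fun i x =>
        P.rho (φ i x) * inner ℝ (v' i x) (ξ i x)
        + P.rho (φ i x) * inner ℝ (fderiv ℝ (v i) x (v i x)) (ξ i x)
        - 1 / 2 * P.rho (φ i x) * inner ℝ (bgrad (fun j y => ‖v j y‖ ^ 2) i x) (ξ i x)
        + inner ℝ (bgrad b i x) (ξ i x)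
        + φ i x / P.cPlus * inner ℝ (bgrad (fun j y => a j y - P.cMinus * b j y) i x) (ξ i x))
    - P.η * formA2 M P v ξ
    + M.intSkeleton (fun e x =>
        - frob (tensor (avg ξ e x) (avg (fun j y => P.rho (φ j y) • v j y) e x))
            (M.tjump v e x)
        + 1 / 2 * inner ℝ (M.jump (fun j y => ‖v j y‖ ^ 2) e x)
            (avg (fun j y => P.rho (φ j y) • ξ j y) e x)
        - inner ℝ (M.jump b e x) (avg ξ e x)
        - 1 / P.cPlus * inner ℝ (M.jump (fun j y => a j y - P.cMinus * b j y) e x)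
            (avg (fun j y => φ j y • ξ j y) e x))

/-- Third equation, tested with `ζ`; `φ'` stands for `∂_t φ`. -/
def Eq3 (φ φ' : Fin N → Pt d → ℝ) (v : Fin N → Pt d → Pt d) (ζ : Fin N → Pt d → ℝ) : Prop :=
  0 = M.intDomain (fun i x =>
        bdiv v i x * ζ i x - P.cMinus / P.cPlus * φ' i x * ζ i x
        - P.cMinus / P.cPlus * bdiv (fun j y => φ j y • v j y) i x * ζ i x)
    + M.intSkeleton (fun e x =>
        M.vjump (fun j y => (P.cMinus / P.cPlus * φ j y) • v j y - v j y) e x * avg ζ e x)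

/-- Fourth equation, tested with `ψ`. -/
def Eq4 (φ lam a : Fin N → Pt d → ℝ) (q : Fin N → Pt d → Pt d) (ψ : Fin N → Pt d → ℝ) : Prop :=
  0 = M.intDomain (fun i x =>
        (a i x - P.cPlus * deriv P.W (φ i x) - P.cMinus * lam i x) * ψ i x
        + P.cPlus * P.γ * bdiv q i x * ψ i x)
    - P.cPlus * P.γ * M.intSkeleton (fun e x => M.vjump q e x * avg ψ e x)

/-- Fifth equation, tested with `υ`. -/
def Eq5 (v : Fin N → Pt d → Pt d) (lam b υ : Fin N → Pt d → ℝ) : Prop :=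
  0 = M.intDomain (fun i x =>
        (b i x - lam i x - (P.ρ₁ + P.ρ₂) / 4 * ‖v i x‖ ^ 2) * υ i x)

/-- Sixth equation, tested with `τ`. -/
def Eq6 (φ : Fin N → Pt d → ℝ) (q τ : Fin N → Pt d → Pt d) : Prop :=
  0 = M.intDomain (fun i x => inner ℝ (q i x) (τ i x) - inner ℝ (bgrad φ i x) (τ i x))
    + M.intSkeleton (fun e x => inner ℝ (M.jump φ e x) (avg τ e x))

/-- `(φ, v, λ, a, b, q)` solves the semidiscrete problem on `[0, T)`. Time derivatives are taken
within `[0, T)`, hence one-sided at `0`. -/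
structure IsSemidiscreteSolution (T : ℝ) (φ : ℝ → FE d N p) (v : ℝ → VFE d N p)
    (lam a b : ℝ → FE d N p) (q : ℝ → VFE d N p) : Prop where
  phi_C1 : ContDiffOn ℝ 1 φ (Ico 0 T)
  v_C1 : ContDiffOn ℝ 1 v (Ico 0 T)
  lam_C0 : ContinuousOn lam (Ico 0 T)
  a_C0 : ContinuousOn a (Ico 0 T)
  b_C0 : ContinuousOn b (Ico 0 T)
  q_C0 : ContinuousOn q (Ico 0 T)
  v_mem : ∀ t ∈ Ico 0 T, v t ∈ feZero M p
  q_mem : ∀ t ∈ Ico 0 T, q t ∈ feNormal M p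
  eq1 : ∀ t ∈ Ico 0 T, ∀ χ : FE d N p,
    Eq1 M P (FE.fn (φ t)) (FE.fn (derivWithin φ (Ico 0 T) t)) (VFE.fn (v t)) (FE.fn (a t))
      (FE.fn χ)
  eq2 : ∀ t ∈ Ico 0 T, ∀ ξ ∈ feZero M p,
    Eq2 M P (FE.fn (φ t)) (VFE.fn (v t)) (VFE.fn (derivWithin v (Ico 0 T) t)) (FE.fn (a t))
      (FE.fn (b t)) (VFE.fn ξ)
  eq3 : ∀ t ∈ Ico 0 T, ∀ ζ : FE d N p,
    Eq3 M P (FE.fn (φ t)) (FE.fn (derivWithin φ (Ico 0 T) t)) (VFE.fn (v t)) (FE.fn ζ)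
  eq4 : ∀ t ∈ Ico 0 T, ∀ ψ : FE d N p,
    Eq4 M P (FE.fn (φ t)) (FE.fn (lam t)) (FE.fn (a t)) (VFE.fn (q t)) (FE.fn ψ)
  eq5 : ∀ t ∈ Ico 0 T, ∀ υ : FE d N p,
    Eq5 M P (VFE.fn (v t)) (FE.fn (lam t)) (FE.fn (b t)) (FE.fn υ)
  eq6 : ∀ t ∈ Ico 0 T, ∀ τ ∈ feNormal M p,
    Eq6 M (FE.fn (φ t)) (VFE.fn (q t)) (VFE.fn τ)

/-- The energy `∫_Ω W(φ) + ½ ρ(φ) |v|² + ½ γ |q|²`. -/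
def energy (φ : Fin N → Pt d → ℝ) (v q : Fin N → Pt d → Pt d) : ℝ :=
  M.intDomain fun i x =>
    P.W (φ i x) + 1 / 2 * P.rho (φ i x) * ‖v i x‖ ^ 2 + 1 / 2 * P.γ * ‖q i x‖ ^ 2

end Scheme

end QuasiIncompressible

end

/-! The identity comes from testing the equations with $\chi=a$, $\xi=v$, $\zeta=b$,
$\psi=\upsilon=\partial_t\phi$ and adding them with weights $1,c_+,c_+,-1,c_-$
(`energy_balance_algebra`). The symmetric forms $\mathcal A_1(a,a)$ and $\mathcal A_2(v,v)$ are
never opened, so neither their sign nor the value of $\sigma$ plays a role. The convective terms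
cancel: inside elements because $((v\cdot\nabla)v)\cdot v=\frac12\nabla(|v|^2)\cdot v$, on
interfaces because $(\{v\}\otimes m):[v]_\otimes=\frac12[|v|^2]\cdot m$ (`eq2_expand`). The fifth
equation brings in $|v|^2\partial_t\phi$, and $c_-(\rho_1+\rho_2)=-c_+(\rho_1-\rho_2)$ makes its
coefficient that of $\frac12\rho'(\phi)\partial_t\phi\,|v|^2$.

What remains are gradients and divergences, and these cancel by broken integration by parts
(`integration_by_parts`) for the pairs $(\partial_t\phi,q)$, $(b,v)$ and $(a-c_-b,\phi v)$; the
boundary conditions remove all terms on $\partial\Omega$. It rests on two facts. First, the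
divergence theorem on a simplex (`integral_interior_fderiv`): integrate by parts on the whole space
against a smooth product cutoff in the barycentric coordinates, and let the cutoff sharpen; its
derivative turns into surface measure on the facets. Second, mesh geometry: a facet not contained in
$\partial\Omega$ belongs to exactly one other element (`exists_neighbor`, `common_facet_unique`),
and the two outward normals are opposite (`normal_eq_neg`).

For the time derivative, $W(\phi)$ and $\rho(\phi)|v|^2$ are $C^1$ in finitely many coefficients and
are differentiated under the integral. The field $q$ is only assumed continuous. The sixth equation
at the times $s$ and $t$, tested with $q(s)+q(t)$, gives
$\|q(s)\|^2-\|q(t)\|^2=B(\phi(s)-\phi(t),q(s)+q(t))$ with the bilinear form $B$ = `gradBilin`;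
dividing by $s-t$ yields the derivative $2B(\partial_t\phi,q)$ without differentiating $q$
(`hasDerivWithinAt_gradient_energy`). -/

noncomputable section

namespace QuasiIncompressible

/-! ### Barycentric coordinates -/

section Barycentric

open Affine

variable {d : ℕ} (s : Affine.Simplex ℝ (Pt d) d)

/-- The vertices of a nondegenerate simplex as an affine basis. -/
def simplexBasis : AffineBasis (Fin (d + 1)) ℝ (Pt d) where
  toFun := s.points
  ind' := s.independent
  tot' := by
    rw [s.independent.affineSpan_eq_top_iff_card_eq_finrank_add_one]
    simp

/-- Barycentric coordinate number `k`. -/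
def bary (k : Fin (d + 1)) : Pt d →ᵃ[ℝ] ℝ := (simplexBasis s).coord k

/-- Gradient of barycentric coordinate number `k`. -/
def baryGrad (k : Fin (d + 1)) : Pt d :=
  (InnerProductSpace.toDual ℝ (Pt d)).symm (LinearMap.toContinuousLinearMap (bary s k).linear)

lemma inner_baryGrad (k : Fin (d + 1)) (e : Pt d) :
    inner ℝ (baryGrad s k) e = (bary s k).linear e := by
  simp [baryGrad]

lemma bary_add (k : Fin (d + 1)) (x e : Pt d) :
    bary s k (x + e) = bary s k x + inner ℝ (baryGrad s k) e := by
  have := (bary s k).map_vadd x e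
  simp only [vadd_eq_add] at this
  rw [inner_baryGrad, add_comm x e, this, add_comm]

lemma bary_sub (k : Fin (d + 1)) (x y : Pt d) :
    bary s k x - bary s k y = inner ℝ (baryGrad s k) (x - y) := by
  have := bary_add s k y (x - y)
  rw [add_sub_cancel] at this
  linarith

lemma bary_points (k j : Fin (d + 1)) : bary s k (s.points j) = if k = j then 1 else 0 :=
  (simplexBasis s).coord_apply k j

lemma sum_bary (x : Pt d) : ∑ k, bary s k x = 1 :=
  (simplexBasis s).sum_coord_apply_eq_one x

lemma sum_bary_smul (x : Pt d) : ∑ k, bary s k x • s.points k = x :=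
  (simplexBasis s).linear_combination_coord_eq_self x

lemma affineCombination_bary (x : Pt d) :
    Finset.univ.affineCombination ℝ s.points (fun k => bary s k x) = x :=
  (simplexBasis s).affineCombination_coord_eq_self x

lemma exists_bary_eq (w : Fin (d + 1) → ℝ) (hw : ∑ k, w k = 1) : ∃ x, ∀ k, bary s k x = w k :=
  ⟨Finset.univ.affineCombination ℝ s.points w, fun k =>
    (simplexBasis s).coord_apply_combination_of_mem (Finset.mem_univ k) hw⟩

lemma affine_apply_eq_sum (ψ : Pt d →ᵃ[ℝ] ℝ) (x : Pt d) :
    ψ x = ∑ k, bary s k x * ψ (s.points k) := by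
  conv_lhs => rw [← affineCombination_bary s x]
  rw [Finset.map_affineCombination _ _ _ (sum_bary s x),
    Finset.affineCombination_eq_linear_combination _ _ _ (sum_bary s x)]
  simp

lemma continuous_bary (k : Fin (d + 1)) : Continuous (bary s k) :=
  (bary s k).continuous_of_finiteDimensional

lemma baryGrad_inner_points_sub (k j l : Fin (d + 1)) :
    inner ℝ (baryGrad s k) (s.points j - s.points l)
      = (if k = j then 1 else 0) - (if k = l then 1 else 0) := by
  rw [← bary_sub, bary_points, bary_points]

lemma eq_zero_of_inner_points_sub {w : Pt d} (b : Fin (d + 1))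
    (h : ∀ a, inner ℝ w (s.points a - s.points b) = 0) : w = 0 := by
  have key : w = ∑ k, bary s k (s.points b + w) • (s.points k - s.points b) := by
    simp only [smul_sub, Finset.sum_sub_distrib]
    rw [← Finset.sum_smul, sum_bary, sum_bary_smul]
    simp
  have : inner ℝ w w = 0 := by
    conv_lhs => arg 3; rw [key]
    simp [inner_sum, inner_smul_right, h]
  exact inner_self_eq_zero.1 this

/-- Orthogonality to the edges of facet `k` leaves one degree of freedom. It is fixed by the edge
from `b` to vertex `k`, on which `baryGrad s k` takes the value 1. -/
lemma eq_smul_baryGrad {w : Pt d} {k b : Fin (d + 1)} (hb : b ≠ k)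
    (h : ∀ a, a ≠ k → inner ℝ w (s.points a - s.points b) = 0) :
    w = (inner ℝ w (s.points k - s.points b) : ℝ) • baryGrad s k := by
  rw [← sub_eq_zero]
  refine eq_zero_of_inner_points_sub s b fun a => ?_
  rw [inner_sub_left, inner_smul_left, baryGrad_inner_points_sub]
  by_cases ha : a = k
  · subst ha
    simp [hb.symm]
  · simp [h a ha, hb.symm, Ne.symm ha]

lemma closedInterior_eq_bary : s.closedInterior = {x | ∀ k, 0 ≤ bary s k x} := by
  rw [← s.convexHull_eq_closedInterior]
  exact (simplexBasis s).convexHull_eq_nonneg_coord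

lemma interior_closedInterior : interior s.closedInterior = {x | ∀ k, 0 < bary s k x} := by
  rw [← s.convexHull_eq_closedInterior]
  exact (simplexBasis s).interior_convexHull

lemma bary_nonneg_of_mem_convexHull {S : Set (Fin (d + 1))} {x : Pt d}
    (hx : x ∈ convexHull ℝ (s.points '' S)) (k : Fin (d + 1)) : 0 ≤ bary s k x := by
  have h : convexHull ℝ (s.points '' S) ⊆ s.closedInterior := by
    rw [← s.convexHull_eq_closedInterior]
    exact convexHull_mono (image_subset_range _ _)
  have := h hx
  rw [closedInterior_eq_bary] at this
  exact this k

lemma bary_eq_zero_of_mem_convexHull {S : Set (Fin (d + 1))} {x : Pt d}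
    (hx : x ∈ convexHull ℝ (s.points '' S)) {k : Fin (d + 1)} (hk : k ∉ S) : bary s k x = 0 := by
  have hc : Convex ℝ ((bary s k) ⁻¹' {0}) := (convex_singleton 0).affine_preimage _
  refine convexHull_min ?_ hc hx
  rintro _ ⟨j, hj, rfl⟩
  have : k ≠ j := fun h => hk (h ▸ hj)
  simp [bary_points, this]

lemma bary_eq_zero_of_mem_affineSpan {k : Fin (d + 1)} {x : Pt d}
    (hx : x ∈ affineSpan ℝ (s.points '' {k}ᶜ)) : bary s k x = 0 := by
  have h : affineSpan ℝ (s.points '' {k}ᶜ)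
      ≤ (affineSpan ℝ ({0} : Set ℝ)).comap (bary s k) := by
    rw [affineSpan_le]
    rintro _ ⟨j, hj, rfl⟩
    have : k ≠ j := fun h => hj h.symm
    simp [bary_points, this]
  simpa using h hx

variable [NeZero d]

lemma exists_ne_vertex (k : Fin (d + 1)) : ∃ b : Fin (d + 1), b ≠ k := by
  have : Nontrivial (Fin (d + 1)) :=
    Fin.nontrivial_iff_two_le.2 (by have := NeZero.pos d; omega)
  exact exists_ne k

lemma baryGrad_ne_zero (k : Fin (d + 1)) : baryGrad s k ≠ 0 := by
  obtain ⟨b, hb⟩ := exists_ne_vertex k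
  intro h
  have := baryGrad_inner_points_sub s k k b
  simp [h, hb.symm] at this

/-- The open simplex also requires coordinates below 1. This follows from positivity because there
is a second vertex, which is where $d\ne0$ enters. -/
lemma simplex_interior_eq_bary : s.interior = {x | ∀ k, 0 < bary s k x} := by
  ext x
  have := Simplex.affineCombination_mem_interior_iff (s := s) (sum_bary s x)
  rw [affineCombination_bary] at this
  rw [this]
  refine ⟨fun h k => (h k).1, fun h k => ⟨h k, ?_⟩⟩
  obtain ⟨b, hb⟩ := exists_ne_vertex k
  rw [← sum_bary s x]
  exact Finset.single_lt_sum hb (Finset.mem_univ _) (Finset.mem_univ _) (h b)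
    fun j _ _ => (h j).le

lemma simplex_interior_eq : s.interior = interior s.closedInterior := by
  rw [simplex_interior_eq_bary, interior_closedInterior]

lemma faceOpposite_closedInterior (k : Fin (d + 1)) :
    (s.faceOpposite k).closedInterior = convexHull ℝ (s.points '' {k}ᶜ) := by
  rw [← Simplex.convexHull_eq_closedInterior, Simplex.range_faceOpposite_points]

lemma faceOpposite_closedInterior_eq_bary (k : Fin (d + 1)) :
    (s.faceOpposite k).closedInterior = {x | bary s k x = 0 ∧ ∀ j, 0 ≤ bary s j x} := by
  ext x
  rw [faceOpposite_closedInterior]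
  constructor
  · intro h
    exact ⟨bary_eq_zero_of_mem_convexHull s h (by simp), bary_nonneg_of_mem_convexHull s h⟩
  · rintro ⟨h0, h⟩
    rw [← sum_bary_smul s x, ← Finset.sum_erase (a := k) _ (by simp [h0])]
    refine (convex_convexHull ℝ _).sum_mem (fun i _ => h i) ?_ ?_
    · rw [Finset.sum_erase Finset.univ (f := fun i => bary s i x) h0, sum_bary]
    · intro i hi
      exact subset_convexHull ℝ _ ⟨i, by simpa using Finset.ne_of_mem_erase hi, rfl⟩

/-- The outward unit normal is the normalized negative gradient of the barycentric coordinate. -/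
lemma normalized_altitude (k : Fin (d + 1)) :
    ‖s.altitudeFoot k - s.points k‖⁻¹ • (s.altitudeFoot k - s.points k)
      = -(‖baryGrad s k‖⁻¹ • baryGrad s k) := by
  obtain ⟨b, hb⟩ := exists_ne_vertex k
  set m := s.altitudeFoot k - s.points k with hm
  have horth : m ∈ (affineSpan ℝ (s.points '' {k}ᶜ)).directionᗮ := by
    rw [hm, ← vsub_eq_sub, Simplex.altitudeFoot, Simplex.orthogonalProjectionSpan]
    simp_rw [Simplex.range_faceOpposite_points]
    exact EuclideanGeometry.orthogonalProjection_vsub_mem_direction_orthogonal _ _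
  have hmem : ∀ a, a ≠ k → s.points a ∈ affineSpan ℝ (s.points '' {k}ᶜ) := fun a ha =>
    mem_affineSpan ℝ ⟨a, ha, rfl⟩
  have h1 : m = (inner ℝ m (s.points k - s.points b) : ℝ) • baryGrad s k := by
    refine eq_smul_baryGrad s hb fun a ha => ?_
    rw [real_inner_comm]
    exact horth _ (AffineSubspace.vsub_mem_direction (hmem a ha) (hmem b hb))
  -- Along the altitude, coordinate `k` falls from 1 at the vertex to 0 at the foot; this decides
  -- the sign of the normal.
  have h2 : inner ℝ (baryGrad s k) m = -1 := by
    rw [hm, ← bary_sub, bary_points, bary_eq_zero_of_mem_affineSpan s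
      (s.altitudeFoot_mem_affineSpan_image_compl k)]
    simp
  set c := (inner ℝ m (s.points k - s.points b) : ℝ)
  have hg := norm_pos_iff.2 (baryGrad_ne_zero s k)
  have h3 : c * ‖baryGrad s k‖ ^ 2 = -1 := by
    rw [h1, inner_smul_right, real_inner_self_eq_norm_sq] at h2
    exact h2
  have hc : c < 0 := by
    by_contra! h
    have := mul_nonneg h (sq_nonneg ‖baryGrad s k‖)
    linarith
  rw [h1, norm_smul, smul_smul, ← neg_smul, Real.norm_eq_abs, abs_of_neg hc]
  congr 1
  have := hc.ne
  field_simp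

end Barycentric

/-! ### Orthogonal coordinates adapted to a hyperplane -/

section Hyperplane

variable {d : ℕ}

/-- Integration in the coordinates `x = p + y + (c r) u` with `u` a unit vector and `y ⟂ u`. -/
lemma integral_orthogonal_coordinates (p u : Pt d) (hu : ‖u‖ = 1) {c : ℝ} (hc : 0 < c)
    (F : Pt d → ℝ) :
    ∫ x, F x = c * ∫ z : ℝ × (Submodule.span ℝ {u})ᗮ, F (p + z.2 + (c * z.1) • u) := by
  have h1 := (Submodule.span ℝ {u}).measurePreserving_measurableEquivProd p
  rw [InnerProductSpace.euclideanHausdorffMeasure_eq_volume] at h1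
  have h2 := (LinearIsometryEquiv.toSpanUnitSingleton (𝕜 := ℝ) u hu).measurePreserving
  let e := LinearIsometryEquiv.toSpanUnitSingleton (𝕜 := ℝ) u hu
  have h3 := h2.prod (MeasurePreserving.id (volume : Measure (Submodule.span ℝ {u})ᗮ))
  have he3 : MeasurableEmbedding (Prod.map e (id : (Submodule.span ℝ {u})ᗮ → _)) :=
    (e.toHomeomorph.prodCongr (Homeomorph.refl _)).measurableEmbedding
  have h4 : Measure.map (Prod.map (fun x => c * x) (id : (Submodule.span ℝ {u})ᗮ → _))
      (volume.prod volume) = ENNReal.ofReal |c⁻¹| • ((volume : Measure ℝ).prod volume) := by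
    rw [← Measure.map_prod_map _ _ (by fun_prop) (by fun_prop), Real.map_volume_mul_left hc.ne',
      Measure.map_id, Measure.prod_smul_left]
  have he4 : MeasurableEmbedding (Prod.map (fun x => c * x)
      (id : (Submodule.span ℝ {u})ᗮ → _)) :=
    ((Homeomorph.mulLeft₀ c hc.ne').prodCongr (Homeomorph.refl _)).measurableEmbedding
  rw [← h1.symm.integral_comp' F, Measure.volume_eq_prod, ← h3.integral_comp he3]
  have h5 : ∀ G : ℝ × (Submodule.span ℝ {u})ᗮ → ℝ,
      ∫ z, G z ∂(volume.prod volume) = c * ∫ z, G (c * z.1, z.2) ∂(volume.prod volume) := by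
    intro G
    have := he4.integral_map (μ := volume.prod volume) G
    rw [h4, integral_smul_measure, ENNReal.toReal_ofReal (abs_nonneg _),
      abs_of_pos (inv_pos.2 hc), smul_eq_mul] at this
    rw [show (∫ z, G (c * z.1, z.2) ∂(volume.prod volume)) = _ from this.symm]
    field_simp
  rw [h5]
  congr 2
  ext z
  simp only [Prod.map_apply, id, Submodule.measurableEquivProd_symm_apply, vadd_eq_add]
  congr 1
  simp only [LinearIsometryEquiv.toSpanUnitSingleton_apply]
  abel

lemma isometry_add_coe (p : Pt d) (V : Submodule ℝ (Pt d)) :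
    Isometry fun y : V => p + (y : Pt d) := by
  intro x y
  rw [edist_add_left]
  rfl

lemma isClosedEmbedding_add_coe (p : Pt d) (V : Submodule ℝ (Pt d)) :
    Topology.IsClosedEmbedding fun y : V => p + (y : Pt d) :=
  (isometry_add_coe p V).isClosedEmbedding

/-- The coordinates are scaled so that the affine function with gradient `g` vanishing at `p` equals
`z.1 / N`. A cutoff layer of width of order `1 / N` thus becomes a layer of fixed width in `z.1`. -/
lemma integral_hyperplane_coordinates (p : Pt d) {g : Pt d} (hg : g ≠ 0) {N : ℝ} (hN : 0 < N)
    (F : Pt d → ℝ) :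
    ∫ x, F x = (N * ‖g‖)⁻¹ * ∫ z : ℝ × (Submodule.span ℝ {g})ᗮ,
      F (p + z.2 + (z.1 / N) • (‖g‖ ^ 2)⁻¹ • g) := by
  have hg' := norm_pos_iff.2 hg
  have hu : ‖‖g‖⁻¹ • g‖ = 1 := by
    rw [norm_smul, norm_inv, norm_norm, inv_mul_cancel₀ hg'.ne']
  have hV : Submodule.span ℝ {‖g‖⁻¹ • g} = Submodule.span ℝ {g} :=
    Submodule.span_singleton_smul_eq (IsUnit.mk0 _ (inv_ne_zero hg'.ne')) g
  have h := integral_orthogonal_coordinates p _ hu (c := (N * ‖g‖)⁻¹) (by positivity) F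
  rw [hV] at h
  rw [h]
  congr 2
  ext z
  rw [smul_smul, smul_smul]
  congr 3
  field_simp

end Hyperplane

/-! ### Surface measure on a facet as Lebesgue measure on a hyperplane -/

section Facet

open Affine

variable {d : ℕ} [NeZero d] (s : Affine.Simplex ℝ (Pt d) d)

lemma finrank_orthogonal_baryGrad (k : Fin (d + 1)) :
    Module.finrank ℝ (Submodule.span ℝ {baryGrad s k})ᗮ = d - 1 := by
  have hd := NeZero.pos d
  have : Fact (Module.finrank ℝ (Pt d) = (d - 1) + 1) := ⟨by simp; omega⟩
  exact Submodule.finrank_orthogonal_span_singleton (baryGrad_ne_zero s k)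

lemma facet_subset_range {k : Fin (d + 1)} {p : Pt d} (hp : bary s k p = 0) :
    (s.faceOpposite k).closedInterior ⊆
      range fun y : (Submodule.span ℝ {baryGrad s k})ᗮ => p + (y : Pt d) := by
  intro x hx
  rw [faceOpposite_closedInterior_eq_bary] at hx
  refine ⟨⟨x - p, ?_⟩, by simp⟩
  rw [Submodule.mem_orthogonal_singleton_iff_inner_right, ← bary_sub, hx.1, hp, sub_zero]

/-- The translation embedding is an isometry of a $(d-1)$-dimensional space, so it carries volume to
Hausdorff measure on its range, and the facet lies in that range. -/
lemma facet_restrict_eq_map {k : Fin (d + 1)} {p : Pt d} (hp : bary s k p = 0) :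
    (μHE[d - 1] : Measure (Pt d)).restrict (s.faceOpposite k).closedInterior =
      (Measure.map (fun y : (Submodule.span ℝ {baryGrad s k})ᗮ => p + (y : Pt d))
        volume).restrict (s.faceOpposite k).closedInterior := by
  rw [← InnerProductSpace.euclideanHausdorffMeasure_eq_volume, finrank_orthogonal_baryGrad,
    (isometry_add_coe p _).map_euclideanHausdorffMeasure,
    Measure.restrict_restrict_of_subset (facet_subset_range s hp)]

lemma isCompact_facet (k : Fin (d + 1)) : IsCompact (s.faceOpposite k).closedInterior :=
  Simplex.isCompact_closedInterior _

/-- Surface integrals over a facet are integrals over the parallel linear hyperplane. -/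
lemma setIntegral_facet {k : Fin (d + 1)} {p : Pt d} (hp : bary s k p = 0) (f : Pt d → ℝ) :
    ∫ x in (s.faceOpposite k).closedInterior, f x ∂μHE[d - 1] =
      ∫ y : (Submodule.span ℝ {baryGrad s k})ᗮ,
        (s.faceOpposite k).closedInterior.indicator f (p + y) := by
  rw [facet_restrict_eq_map s hp, ← integral_indicator (isCompact_facet s k).measurableSet,
    (isClosedEmbedding_add_coe p _).measurableEmbedding.integral_map]

lemma facet_measure_lt_top (k : Fin (d + 1)) :
    (μHE[d - 1] : Measure (Pt d)) (s.faceOpposite k).closedInterior < ⊤ := by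
  obtain ⟨b, hb⟩ := exists_ne_vertex k
  have hp : bary s k (s.points b) = 0 := by simp [bary_points, hb.symm]
  rw [← Measure.restrict_apply_self, facet_restrict_eq_map s hp, Measure.restrict_apply_self,
    (isClosedEmbedding_add_coe _ _).measurableEmbedding.map_apply]
  exact ((isClosedEmbedding_add_coe _ _).isCompact_preimage (isCompact_facet s k)).measure_lt_top

lemma integrableOn_facet (k : Fin (d + 1)) {f : Pt d → ℝ} (hf : Continuous f) :
    IntegrableOn f (s.faceOpposite k).closedInterior (μHE[d - 1]) := by
  obtain ⟨C, hC⟩ := (isCompact_facet s k).exists_bound_of_continuousOn hf.continuousOn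
  refine Measure.integrableOn_of_bounded (M := C) (facet_measure_lt_top s k).ne
    hf.aestronglyMeasurable ?_
  exact (ae_restrict_iff' (isCompact_facet s k).measurableSet).2 (.of_forall hC)

end Facet

/-! ### A smooth step whose derivative has mass one -/

section Transition

open Filter Topology

lemma contDiff_smoothTransition : ContDiff ℝ 1 Real.smoothTransition :=
  Real.smoothTransition.contDiff

lemma continuous_deriv_smoothTransition : Continuous (deriv Real.smoothTransition) :=
  contDiff_smoothTransition.continuous_deriv le_rfl

lemma hasDerivAt_smoothTransition (r : ℝ) :
    HasDerivAt Real.smoothTransition (deriv Real.smoothTransition r) r :=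
  (contDiff_smoothTransition.differentiable one_ne_zero r).hasDerivAt

lemma deriv_smoothTransition_of_notMem {r : ℝ} (hr : r ∉ Icc (0 : ℝ) 1) :
    deriv Real.smoothTransition r = 0 := by
  rw [mem_Icc, not_and_or, not_le, not_le] at hr
  rcases hr with hr | hr
  · have : Real.smoothTransition =ᶠ[𝓝 r] fun _ => 0 := by
      filter_upwards [Iio_mem_nhds hr] with x hx
      exact Real.smoothTransition.zero_of_nonpos (le_of_lt hx)
    rw [this.deriv_eq, deriv_const]
  · have : Real.smoothTransition =ᶠ[𝓝 r] fun _ => 1 := by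
      filter_upwards [Ioi_mem_nhds hr] with x hx
      exact Real.smoothTransition.one_of_one_le (le_of_lt hx)
    rw [this.deriv_eq, deriv_const]

lemma hasCompactSupport_deriv_smoothTransition :
    HasCompactSupport (deriv Real.smoothTransition) :=
  HasCompactSupport.intro isCompact_Icc fun _ => deriv_smoothTransition_of_notMem

lemma integral_deriv_smoothTransition : ∫ r, deriv Real.smoothTransition r = 1 := by
  have h0 : Tendsto Real.smoothTransition atBot (𝓝 0) := by
    refine tendsto_const_nhds.congr' ?_
    filter_upwards [eventually_le_atBot (0 : ℝ)] with x hx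
    exact (Real.smoothTransition.zero_of_nonpos hx).symm
  have h1 : Tendsto Real.smoothTransition atTop (𝓝 1) := by
    refine tendsto_const_nhds.congr' ?_
    filter_upwards [eventually_ge_atTop (1 : ℝ)] with x hx
    exact (Real.smoothTransition.one_of_one_le hx).symm
  simpa using integral_of_hasDerivAt_of_tendsto hasDerivAt_smoothTransition
    (continuous_deriv_smoothTransition.integrable_of_hasCompactSupport
      hasCompactSupport_deriv_smoothTransition) h0 h1

end Transition

/-! ### The divergence theorem on a simplex by smooth cutoffs -/

section DivergenceTheorem

open Affine Filter Topology

variable {d : ℕ} (s : Affine.Simplex ℝ (Pt d) d)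

/-- Smooth cutoff to the set where the barycentric coordinates in `A` are positive. -/
def cutoff (A : Finset (Fin (d + 1))) (N : ℝ) (x : Pt d) : ℝ :=
  ∏ j ∈ A, Real.smoothTransition (N * bary s j x)

lemma continuous_cutoff (A : Finset (Fin (d + 1))) (N : ℝ) : Continuous (cutoff s A N) :=
  continuous_finsetProd _ fun j _ =>
    Real.smoothTransition.continuous.comp (continuous_const.mul (continuous_bary s j))

lemma cutoff_nonneg (A : Finset (Fin (d + 1))) (N : ℝ) (x : Pt d) : 0 ≤ cutoff s A N x :=
  Finset.prod_nonneg fun _ _ => Real.smoothTransition.nonneg _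

lemma cutoff_le_one (A : Finset (Fin (d + 1))) (N : ℝ) (x : Pt d) : cutoff s A N x ≤ 1 :=
  Finset.prod_le_one (fun _ _ => Real.smoothTransition.nonneg _)
    fun _ _ => Real.smoothTransition.le_one _

lemma cutoff_eq_zero {A : Finset (Fin (d + 1))} {N : ℝ} (hN : 0 < N) {x : Pt d}
    {j : Fin (d + 1)} (hj : j ∈ A) (hx : bary s j x ≤ 0) : cutoff s A N x = 0 :=
  Finset.prod_eq_zero hj (Real.smoothTransition.zero_of_nonpos
    (mul_nonpos_of_nonneg_of_nonpos hN.le hx))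

lemma hasFDerivAt_bary (k : Fin (d + 1)) (x : Pt d) :
    HasFDerivAt (bary s k) (innerSL ℝ (baryGrad s k)) x := by
  have h : (bary s k : Pt d → ℝ) = fun x => innerSL ℝ (baryGrad s k) x + bary s k 0 := by
    ext x
    have := bary_add s k 0 x
    rw [zero_add] at this
    rw [this, add_comm]
    rfl
  rw [h]
  exact (innerSL ℝ (baryGrad s k)).hasFDerivAt.add_const _

lemma hasFDerivAt_cutoff (A : Finset (Fin (d + 1))) (N : ℝ) (x : Pt d) :
    HasFDerivAt (cutoff s A N)
      (∑ k ∈ A, (cutoff s (A.erase k) N x * (deriv Real.smoothTransition (N * bary s k x) * N)) •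
        innerSL ℝ (baryGrad s k)) x := by
  have h : ∀ k ∈ A, HasFDerivAt (fun x => Real.smoothTransition (N * bary s k x))
      ((deriv Real.smoothTransition (N * bary s k x) * N) • innerSL ℝ (baryGrad s k)) x := by
    intro k _
    have := (hasDerivAt_smoothTransition (N * bary s k x)).comp_hasFDerivAt x
      ((hasFDerivAt_bary s k x).const_mul N)
    rw [smul_smul] at this
    exact this
  have := HasFDerivAt.finsetProd h
  simp only [smul_smul] at this
  exact this

/-- Derivative-of-cutoff integrals concentrate on a facet. -/
lemma tendsto_integral_deriv_cutoff [NeZero d] (k : Fin (d + 1)) {f : Pt d → ℝ}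
    (hf : Continuous f) :
    Tendsto (fun n : ℕ => ∫ x, cutoff s (Finset.univ.erase k) (n + 1) x *
        (deriv Real.smoothTransition ((n + 1) * bary s k x) * (n + 1)) * f x) atTop
      (𝓝 (‖baryGrad s k‖⁻¹ * ∫ x in (s.faceOpposite k).closedInterior, f x ∂μHE[d - 1])) := by
  obtain ⟨b, hb⟩ := exists_ne_vertex k
  set p := s.points b with hpdef
  have hp : bary s k p = 0 := by simp [hpdef, bary_points, hb.symm]
  set g := baryGrad s k with hgdef
  have hg : g ≠ 0 := baryGrad_ne_zero s k
  have hg' := norm_pos_iff.2 hg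
  set w : Pt d := (‖g‖ ^ 2)⁻¹ • g with hw
  let V := (Submodule.span ℝ {g})ᗮ
  have hgw : inner ℝ g w = 1 := by
    rw [hw, inner_smul_right, real_inner_self_eq_norm_sq]
    field_simp
  have hgy : ∀ y : V, inner ℝ g (y : Pt d) = 0 := fun y =>
    Submodule.mem_orthogonal_singleton_iff_inner_right.1 y.2
  have hbk : ∀ (y : V) (r : ℝ), bary s k (p + y + r • w) = r := by
    intro y r
    rw [bary_add, bary_add, hp, hgy, inner_smul_right, hgw]
    ring
  -- The factor `n + 1` is absorbed by the Jacobian, so the profile in `z.1` no longer depends on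
  -- `n`; only the evaluation point moves, towards `p + z.2` in the facet's hyperplane.
  let Φ : ℕ → ℝ × V → ℝ := fun n z => deriv Real.smoothTransition z.1 *
    (cutoff s (Finset.univ.erase k) (n + 1) (p + z.2 + (z.1 / (n + 1)) • w) *
      f (p + z.2 + (z.1 / (n + 1)) • w))
  have hN : ∀ n : ℕ, (0 : ℝ) < n + 1 := fun n => by positivity
  have h1 : ∀ n : ℕ, ∫ x, cutoff s (Finset.univ.erase k) (n + 1) x *
        (deriv Real.smoothTransition ((n + 1) * bary s k x) * (n + 1)) * f x
        = ‖g‖⁻¹ * ∫ z, Φ n z := by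
    intro n
    rw [integral_hyperplane_coordinates p hg (hN n), mul_inv, mul_comm _ ‖g‖⁻¹, mul_assoc,
      ← integral_const_mul]
    congr 2
    ext z
    rw [← hw, hbk, mul_div_cancel₀ _ (hN n).ne']
    simp only [Φ]
    have := (hN n).ne'
    field_simp
  simp_rw [h1]
  refine Tendsto.const_mul _ ?_
  have h2 : ∫ x in (s.faceOpposite k).closedInterior, f x ∂μHE[d - 1] =
      ∫ z : ℝ × V, deriv Real.smoothTransition z.1 *
        (s.faceOpposite k).closedInterior.indicator f (p + z.2) := by
    rw [Measure.volume_eq_prod, integral_prod_mul (deriv Real.smoothTransition)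
      (fun y : V => (s.faceOpposite k).closedInterior.indicator f (p + y)),
      integral_deriv_smoothTransition, one_mul, setIntegral_facet s hp]
  rw [h2]
  obtain ⟨C₁, hC₁⟩ := isCompact_Icc.exists_bound_of_continuousOn
    (continuous_deriv_smoothTransition.continuousOn (s := Icc (0 : ℝ) 1))
  obtain ⟨C₂, hC₂⟩ := s.isCompact_closedInterior.exists_bound_of_continuousOn hf.continuousOn
  obtain ⟨R, hR⟩ := s.isCompact_closedInterior.isBounded.exists_norm_le
  -- Where the integrand is nonzero, the evaluation point lies in the simplex and `z.1 / (n + 1)` is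
  -- at most 1, so this radius bounds `z.2` for every `n`.
  set R' := R + ‖p‖ + ‖w‖
  set B : Set (ℝ × V) := Icc (0 : ℝ) 1 ×ˢ Metric.closedBall 0 R'
  have hB : IsCompact B := isCompact_Icc.prod (isCompact_closedBall _ _)
  have hC₁0 : 0 ≤ C₁ := (norm_nonneg _).trans (hC₁ 0 (by simp))
  have hC₂0 : 0 ≤ C₂ := (norm_nonneg _).trans (hC₂ _ (s.point_mem_closedInterior 0))
  refine tendsto_integral_of_dominated_convergence (B.indicator fun _ => C₁ * C₂) ?_ ?_ ?_ ?_
  · intro n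
    refine Continuous.aestronglyMeasurable ?_
    have hc : Continuous fun z : ℝ × V => p + (z.2 : Pt d) + (z.1 / (n + 1)) • w := by fun_prop
    exact (continuous_deriv_smoothTransition.comp continuous_fst).mul
      (((continuous_cutoff s _ _).comp hc).mul (hf.comp hc))
  · exact (integrable_indicator_iff hB.measurableSet).2
      (integrableOn_const hB.measure_lt_top.ne)
  · intro n
    refine .of_forall fun z => ?_
    by_cases hz1 : z.1 ∈ Icc (0 : ℝ) 1
    swap
    · simp only [Φ, deriv_smoothTransition_of_notMem hz1, zero_mul, norm_zero]
      exact indicator_nonneg (fun _ _ => mul_nonneg hC₁0 hC₂0) _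
    by_cases hz2 : ∀ j ∈ Finset.univ.erase k, 0 < bary s j (p + z.2 + (z.1 / (n + 1)) • w)
    swap
    · push Not at hz2
      obtain ⟨j, hj, hj0⟩ := hz2
      simp only [Φ, cutoff_eq_zero s (hN n) hj hj0, zero_mul, mul_zero, norm_zero]
      exact indicator_nonneg (fun _ _ => mul_nonneg hC₁0 hC₂0) _
    set x := p + (z.2 : Pt d) + (z.1 / (n + 1)) • w with hx
    have hxK : x ∈ s.closedInterior := by
      rw [closedInterior_eq_bary]
      intro j
      by_cases hj : j = k
      · rw [hj, hx, hbk]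
        exact div_nonneg hz1.1 (hN n).le
      · exact (hz2 j (by simp [hj])).le
    have hzB : z ∈ B := by
      refine ⟨hz1, ?_⟩
      rw [mem_closedBall_zero_iff]
      have : (z.2 : Pt d) = x - p - (z.1 / (n + 1)) • w := by rw [hx]; abel
      have h3 : ‖(z.1 / (n + 1)) • w‖ ≤ ‖w‖ := by
        rw [norm_smul, Real.norm_eq_abs, abs_of_nonneg (div_nonneg hz1.1 (hN n).le)]
        refine mul_le_of_le_one_left (norm_nonneg _) ?_
        rw [div_le_one (hN n)]
        have := hz1.2
        have : (0 : ℝ) ≤ n := by positivity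
        linarith
      rw [← Submodule.norm_coe, this]
      calc _ ≤ ‖x - p‖ + ‖(z.1 / (n + 1)) • w‖ := norm_sub_le _ _
        _ ≤ ‖x‖ + ‖p‖ + ‖w‖ := add_le_add (norm_sub_le _ _) h3
        _ ≤ R' := by simp only [R']; linarith [hR x hxK]
    rw [indicator_of_mem hzB, norm_mul, norm_mul]
    refine mul_le_mul (hC₁ _ hz1) ?_ (by positivity) hC₁0
    refine (mul_le_of_le_one_left (norm_nonneg _) ?_).trans (hC₂ _ hxK)
    rw [Real.norm_eq_abs, abs_of_nonneg (cutoff_nonneg _ _ _ _)]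
    exact cutoff_le_one _ _ _ _
  -- The cutoff tends to the indicator of the facet except possibly where another coordinate
  -- vanishes. That exceptional set is a proper affine subspace of the hyperplane, since vertex `j`
  -- belongs to the facet's hyperplane and has coordinate 1; hence it is null.
  · have hnull : ∀ j, j ≠ k → ∀ᵐ z : ℝ × V, bary s j (p + z.2) ≠ 0 := by
      intro j hj
      let A : AffineSubspace ℝ V := (affineSpan ℝ ({0} : Set ℝ)).comap
        ((bary s j).comp ((AffineMap.const ℝ V p) + V.subtype.toAffineMap))
      have hA : ∀ y : V, y ∈ A ↔ bary s j (p + y) = 0 := by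
        intro y
        simp [A]
      have hAtop : A ≠ ⊤ := by
        intro h
        have hy : s.points j - p ∈ V := by
          rw [Submodule.mem_orthogonal_singleton_iff_inner_right, hgdef, hpdef,
            baryGrad_inner_points_sub]
          simp [hj.symm, hb.symm]
        have : (⟨s.points j - p, hy⟩ : V) ∈ A := h ▸ AffineSubspace.mem_top ℝ V _
        rw [hA] at this
        simp [bary_points] at this
      have h0 : ∀ᵐ y : V, bary s j (p + y) ≠ 0 := by
        refine measure_mono_null ?_ (Measure.addHaar_affineSubspace volume A hAtop)
        intro y hy
        simpa [hA] using hy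
      exact (Measure.quasiMeasurePreserving_snd (μ := (volume : Measure ℝ))).ae h0
    have hall : ∀ᵐ z : ℝ × V, ∀ j, j ≠ k → bary s j (p + z.2) ≠ 0 := by
      rw [ae_all_iff]
      intro j
      by_cases hj : j = k
      · simp [hj]
      · simpa [hj] using hnull j hj
    filter_upwards [hall] with z hz
    refine Tendsto.const_mul _ ?_
    have hnat : Tendsto (fun n : ℕ => (n : ℝ) + 1) atTop atTop :=
      tendsto_atTop_add_const_right _ _ tendsto_natCast_atTop_atTop
    have hpt : Tendsto (fun n : ℕ => p + (z.2 : Pt d) + (z.1 / (n + 1)) • w) atTop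
        (𝓝 (p + z.2)) := by
      have : Tendsto (fun n : ℕ => z.1 / ((n : ℝ) + 1)) atTop (𝓝 0) :=
        tendsto_const_nhds.div_atTop hnat
      simpa using (tendsto_const_nhds (x := p + (z.2 : Pt d))).add (this.smul_const w)
    have hbary : ∀ j (n : ℕ), ((n : ℝ) + 1) * bary s j (p + z.2 + (z.1 / (n + 1)) • w)
        = (n + 1) * bary s j (p + z.2) + z.1 * inner ℝ (baryGrad s j) w := by
      intro j n
      rw [bary_add, inner_smul_right]
      have := (hN n).ne'
      field_simp
    have hbk0 : bary s k (p + (z.2 : Pt d)) = 0 := by simpa using hbk z.2 0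
    by_cases hmem : p + (z.2 : Pt d) ∈ (s.faceOpposite k).closedInterior
    · rw [indicator_of_mem hmem]
      rw [faceOpposite_closedInterior_eq_bary] at hmem
      have hone : ∀ᶠ n : ℕ in atTop, cutoff s (Finset.univ.erase k) (n + 1)
          (p + z.2 + (z.1 / (n + 1)) • w) = 1 := by
        have : ∀ᶠ n : ℕ in atTop, ∀ j ∈ Finset.univ.erase k,
            1 ≤ ((n : ℝ) + 1) * bary s j (p + z.2 + (z.1 / (n + 1)) • w) := by
          rw [Filter.eventually_all_finset]
          intro j hj
          simp_rw [hbary]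
          have hpos : 0 < bary s j (p + z.2) :=
            lt_of_le_of_ne (hmem.2 j) (hz j (Finset.ne_of_mem_erase hj)).symm
          exact (tendsto_atTop_add_const_right _ _
            (hnat.atTop_mul_const hpos)).eventually_ge_atTop 1
        filter_upwards [this] with n hn
        exact Finset.prod_eq_one fun j hj => Real.smoothTransition.one_of_one_le (hn j hj)
      refine ((hf.tendsto _).comp hpt).congr' ?_
      filter_upwards [hone] with n hn
      simp [hn]
    · rw [indicator_of_notMem hmem]
      have : ∃ j, j ≠ k ∧ bary s j (p + z.2) < 0 := by
        by_contra! h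
        refine hmem ?_
        rw [faceOpposite_closedInterior_eq_bary]
        refine ⟨hbk0, fun j => ?_⟩
        by_cases hj : j = k
        · rw [hj, hbk0]
        · exact h j hj
      obtain ⟨j, hjk, hj⟩ := this
      refine tendsto_const_nhds.congr' ?_
      have : ∀ᶠ n : ℕ in atTop,
          ((n : ℝ) + 1) * bary s j (p + z.2 + (z.1 / (n + 1)) • w) ≤ 0 := by
        simp_rw [hbary]
        exact (tendsto_atBot_add_const_right _ _
          (hnat.atTop_mul_const_of_neg hj)).eventually_le_atBot 0
      filter_upwards [this] with n hn
      have : cutoff s (Finset.univ.erase k) (n + 1) (p + z.2 + (z.1 / (n + 1)) • w) = 0 :=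
        Finset.prod_eq_zero (i := j) (by simp [hjk]) (Real.smoothTransition.zero_of_nonpos hn)
      rw [this, zero_mul]

lemma hasCompactSupport_of_closedInterior {f : Pt d → ℝ} (h : ∀ x ∉ s.closedInterior, f x = 0) :
    HasCompactSupport f :=
  HasCompactSupport.intro s.isCompact_closedInterior fun _ => h _

lemma exists_bary_neg {x : Pt d} (hx : x ∉ s.closedInterior) : ∃ j, bary s j x < 0 := by
  rw [closedInterior_eq_bary] at hx
  simpa using hx

lemma cutoff_univ_eq_zero {N : ℝ} (hN : 0 < N) {x : Pt d} (hx : x ∉ s.closedInterior) :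
    cutoff s Finset.univ N x = 0 := by
  obtain ⟨j, hj⟩ := exists_bary_neg s hx
  exact cutoff_eq_zero s hN (Finset.mem_univ j) hj.le

lemma tendsto_integral_cutoff [NeZero d] {f : Pt d → ℝ} (hf : Continuous f) :
    Tendsto (fun n : ℕ => ∫ x, cutoff s Finset.univ (n + 1) x * f x) atTop
      (𝓝 (∫ x in s.interior, f x)) := by
  have hm : MeasurableSet s.interior := by
    rw [simplex_interior_eq]
    exact isOpen_interior.measurableSet
  have hN : ∀ n : ℕ, (0 : ℝ) < n + 1 := fun n => by positivity
  rw [← integral_indicator hm]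
  have hK := s.isCompact_closedInterior
  refine tendsto_integral_of_dominated_convergence
    (s.closedInterior.indicator fun x => ‖f x‖) ?_ ?_ ?_ ?_
  · exact fun n => ((continuous_cutoff s _ _).mul hf).aestronglyMeasurable
  · exact (integrable_indicator_iff hK.measurableSet).2
      (hf.norm.continuousOn.integrableOn_compact hK)
  · refine fun n => .of_forall fun x => ?_
    by_cases hx : x ∈ s.closedInterior
    · rw [indicator_of_mem hx, norm_mul, Real.norm_of_nonneg (cutoff_nonneg _ _ _ _)]
      exact mul_le_of_le_one_left (norm_nonneg _) (cutoff_le_one _ _ _ _)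
    · simp [cutoff_univ_eq_zero s (hN n) hx, indicator_of_notMem hx]
  · refine .of_forall fun x => ?_
    by_cases hx : x ∈ s.interior
    · rw [indicator_of_mem hx]
      rw [simplex_interior_eq_bary] at hx
      have hnat : Tendsto (fun n : ℕ => (n : ℝ) + 1) atTop atTop :=
        tendsto_atTop_add_const_right _ _ tendsto_natCast_atTop_atTop
      have : ∀ᶠ n : ℕ in atTop, ∀ j, 1 ≤ ((n : ℝ) + 1) * bary s j x := by
        rw [Filter.eventually_all]
        exact fun j => (hnat.atTop_mul_const (hx j)).eventually_ge_atTop 1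
      refine tendsto_const_nhds.congr' ?_
      filter_upwards [this] with n hn
      have : cutoff s Finset.univ (n + 1) x = 1 :=
        Finset.prod_eq_one fun j _ => Real.smoothTransition.one_of_one_le (hn j)
      rw [this, one_mul]
    · rw [indicator_of_notMem hx]
      rw [simplex_interior_eq_bary] at hx
      obtain ⟨j, hj⟩ : ∃ j, bary s j x ≤ 0 := by simpa using hx
      refine tendsto_const_nhds.congr fun n => ?_
      rw [cutoff_eq_zero s (hN n) (Finset.mem_univ j) hj, zero_mul]

/-- The divergence theorem on a simplex, for the vector field `f e` with `e` constant. -/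
theorem integral_interior_fderiv [NeZero d] {f : Pt d → ℝ} (hf : ContDiff ℝ 1 f) (e : Pt d) :
    ∫ x in s.interior, fderiv ℝ f x e =
      ∑ k, inner ℝ (-(‖baryGrad s k‖⁻¹ • baryGrad s k)) e *
        ∫ x in (s.faceOpposite k).closedInterior, f x ∂μHE[d - 1] := by
  have hN : ∀ n : ℕ, (0 : ℝ) < n + 1 := fun n => by positivity
  have hf' : Continuous fun x => fderiv ℝ f x e :=
    (hf.continuous_fderiv one_ne_zero).clm_apply continuous_const
  have hcont : ∀ (n : ℕ) k, Continuous fun x => cutoff s (Finset.univ.erase k) (n + 1) x *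
      (deriv Real.smoothTransition ((n + 1) * bary s k x) * (n + 1)) * f x := fun n k =>
    ((continuous_cutoff s _ _).mul ((continuous_deriv_smoothTransition.comp
      (continuous_const.mul (continuous_bary s k))).mul continuous_const)).mul hf.continuous
  have hint : ∀ (n : ℕ) k, Integrable fun x => cutoff s (Finset.univ.erase k) (n + 1) x *
      (deriv Real.smoothTransition ((n + 1) * bary s k x) * (n + 1)) * f x := by
    intro n k
    refine (hcont n k).integrable_of_hasCompactSupport
      (hasCompactSupport_of_closedInterior s fun x hx => ?_)
    obtain ⟨j, hj⟩ := exists_bary_neg s hx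
    by_cases hjk : j = k
    · subst hjk
      rw [deriv_smoothTransition_of_notMem]
      · simp
      · exact fun h => absurd h.1 (not_le.2 (mul_neg_of_pos_of_neg (hN n) hj))
    · rw [cutoff_eq_zero s (hN n) (by simpa using hjk) hj.le]
      simp
  -- The cutoff has compact support, so integration by parts on the whole space produces no boundary
  -- term; the boundary reappears as the derivative of the cutoff, one summand per facet.
  have hparts : ∀ n : ℕ, ∫ x, cutoff s Finset.univ (n + 1) x * fderiv ℝ f x e =
      ∑ k, -inner ℝ (baryGrad s k) e * ∫ x, cutoff s (Finset.univ.erase k) (n + 1) x *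
        (deriv Real.smoothTransition ((n + 1) * bary s k x) * (n + 1)) * f x := by
    intro n
    have hder : ∀ x, fderiv ℝ (cutoff s Finset.univ (n + 1)) x e * f x =
        ∑ k, inner ℝ (baryGrad s k) e * (cutoff s (Finset.univ.erase k) (n + 1) x *
          (deriv Real.smoothTransition ((n + 1) * bary s k x) * (n + 1)) * f x) := by
      intro x
      rw [(hasFDerivAt_cutoff s Finset.univ (n + 1) x).fderiv, sum_apply,
        Finset.sum_mul]
      refine Finset.sum_congr rfl fun k _ => ?_
      simp only [smul_apply, innerSL_apply_apply, smul_eq_mul]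
      ring
    have hzero : ∀ x ∉ s.closedInterior, cutoff s Finset.univ ((n : ℝ) + 1) x = 0 := fun x hx =>
      cutoff_univ_eq_zero s (hN n) hx
    rw [integral_mul_fderiv_eq_neg_fderiv_mul_of_integrable]
    · simp_rw [hder]
      rw [integral_finsetSum _ fun k _ => (hint n k).const_mul _, ← Finset.sum_neg_distrib]
      refine Finset.sum_congr rfl fun k _ => ?_
      rw [integral_const_mul, neg_mul]
    · simp_rw [hder]
      exact integrable_finsetSum _ fun k _ => (hint n k).const_mul _
    · exact ((continuous_cutoff s _ _).mul hf').integrable_of_hasCompactSupport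
        (hasCompactSupport_of_closedInterior s fun x hx => by rw [Pi.mul_apply, hzero x hx, zero_mul])
    · exact ((continuous_cutoff s _ _).mul hf.continuous).integrable_of_hasCompactSupport
        (hasCompactSupport_of_closedInterior s fun x hx => by rw [Pi.mul_apply, hzero x hx, zero_mul])
    · exact fun x _ => (hasFDerivAt_cutoff s _ _ x).differentiableAt
    · exact fun x _ => hf.differentiable one_ne_zero x
  refine tendsto_nhds_unique (tendsto_integral_cutoff s hf') ?_
  simp_rw [hparts]
  refine tendsto_finsetSum _ fun k _ => ?_
  have := (tendsto_integral_deriv_cutoff s k hf.continuous).const_mul (-inner ℝ (baryGrad s k) e)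
  convert this using 2
  rw [inner_neg_left, inner_smul_left]
  simp
  ring

end DivergenceTheorem

/-! ### Two simplices with a common facet -/

section SharedFacets

open Affine Filter Topology

variable {d : ℕ} [NeZero d] (s s' : Affine.Simplex ℝ (Pt d) d)

lemma point_mem_facet {a k : Fin (d + 1)} (h : a ≠ k) :
    s.points a ∈ (s.faceOpposite k).closedInterior := by
  rw [faceOpposite_closedInterior]
  exact subset_convexHull ℝ _ ⟨a, h, rfl⟩

lemma facet_subset_closedInterior (k : Fin (d + 1)) :
    (s.faceOpposite k).closedInterior ⊆ s.closedInterior := by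
  rw [faceOpposite_closedInterior_eq_bary, closedInterior_eq_bary]
  exact fun x hx => hx.2

/-- The centroid of the facet, with weight $1/d$ at each of its $d$ vertices. -/
lemma exists_bary_facet_pos (k : Fin (d + 1)) :
    ∃ x, bary s k x = 0 ∧ ∀ j, j ≠ k → 0 < bary s j x := by
  have hd : (0 : ℝ) < d := by exact_mod_cast NeZero.pos d
  obtain ⟨x, hx⟩ := exists_bary_eq s (fun j => if j = k then 0 else (d : ℝ)⁻¹) (by
    rw [Finset.sum_ite]
    have : (Finset.univ.filter fun j : Fin (d + 1) => ¬ j = k).card = d := by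
      rw [← Finset.compl_filter, Finset.card_compl]
      simp [Finset.filter_eq']
    simp only [Finset.sum_const, this]
    simp [hd.ne'])
  refine ⟨x, by simp [hx], fun j hj => ?_⟩
  simp [hx, hj, hd]

variable {s s'}

/-- An affine function that vanishes on a facet is determined by its value at the opposite vertex,
and that value is `c`. -/
lemma bary_eq_mul_of_facet_subset {k l : Fin (d + 1)}
    (h : ∀ x ∈ (s.faceOpposite k).closedInterior, bary s' l x = 0) :
    ∃ c : ℝ, baryGrad s' l = c • baryGrad s k ∧ ∀ x, bary s' l x = c * bary s k x := by
  obtain ⟨b, hb⟩ := exists_ne_vertex k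
  have h1 : ∀ a, a ≠ k → bary s' l (s.points a) = 0 := fun a ha => h _ (point_mem_facet s ha)
  have h2 := eq_smul_baryGrad s (w := baryGrad s' l) hb fun a ha => by
    rw [← bary_sub, h1 a ha, h1 b hb, sub_zero]
  refine ⟨_, h2, fun x => ?_⟩
  have h3 := bary_sub s' l x (s.points b)
  have h4 := bary_sub s k x (s.points b)
  rw [h1 b hb, sub_zero] at h3
  rw [bary_points, if_neg hb.symm, sub_zero] at h4
  rw [h3, h4]
  conv_lhs => rw [h2]
  rw [inner_smul_left]
  rfl

/-- Both coordinates would be nonzero multiples of the same function `bary s k`, yet at vertex `l`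
of `s'` one is 1 and the other 0 if they differ. -/
lemma eq_of_facet_subset {k l m : Fin (d + 1)}
    (hl : ∀ x ∈ (s.faceOpposite k).closedInterior, bary s' l x = 0)
    (hm : ∀ x ∈ (s.faceOpposite k).closedInterior, bary s' m x = 0) : l = m := by
  obtain ⟨c, -, hc⟩ := bary_eq_mul_of_facet_subset hl
  obtain ⟨c', hg', hc'⟩ := bary_eq_mul_of_facet_subset hm
  by_contra hlm
  have h1 := hc (s'.points l)
  have h2 := hc' (s'.points l)
  rw [bary_points, if_pos rfl] at h1
  rw [bary_points, if_neg (Ne.symm hlm)] at h2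
  rcases mul_eq_zero.1 h2.symm with h | h
  · rw [h, zero_smul] at hg'
    exact baryGrad_ne_zero s' m hg'
  · rw [h, mul_zero] at h1
    exact one_ne_zero h1

/-- Minimum principle: a nonnegative affine function on the facet that vanishes at a relative
interior point vanishes at every vertex of the facet. -/
lemma bary_eq_zero_on_facet {k j : Fin (d + 1)} {x : Pt d} (hxk : bary s k x = 0)
    (hx : ∀ m, m ≠ k → 0 < bary s m x)
    (hsub : (s.faceOpposite k).closedInterior ⊆ s'.closedInterior) (hj : bary s' j x = 0) :
    ∀ y ∈ (s.faceOpposite k).closedInterior, bary s' j y = 0 := by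
  have hnn : ∀ m, m ≠ k → 0 ≤ bary s' j (s.points m) := fun m hm => by
    have := hsub (point_mem_facet s hm)
    rw [closedInterior_eq_bary] at this
    exact this j
  have hterm : ∀ m, bary s m x * bary s' j (s.points m) = 0 := by
    have hsum := affine_apply_eq_sum s (bary s' j) x
    rw [hj, eq_comm, Finset.sum_eq_zero_iff_of_nonneg] at hsum
    · exact fun m => hsum m (Finset.mem_univ m)
    · intro m _
      by_cases hm : m = k
      · simp [hm, hxk]
      · exact mul_nonneg (hx m hm).le (hnn m hm)
  intro y hy
  rw [affine_apply_eq_sum s]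
  refine Finset.sum_eq_zero fun m _ => ?_
  by_cases hm : m = k
  · rw [faceOpposite_closedInterior_eq_bary] at hy
    rw [hm, hy.1, zero_mul]
  · rw [(mul_eq_zero.1 (hterm m)).resolve_left (hx m hm).ne', mul_zero]

/-- Two simplices that only meet in a common facet lie on opposite sides of it. -/
lemma baryGrad_of_common_facet {k l : Fin (d + 1)}
    (hF : (s.faceOpposite k).closedInterior = (s'.faceOpposite l).closedInterior)
    (hinter : s.closedInterior ∩ s'.closedInterior ⊆ (s.faceOpposite k).closedInterior) :
    ∃ c < (0 : ℝ), baryGrad s' l = c • baryGrad s k := by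
  have hFl : ∀ x ∈ (s.faceOpposite k).closedInterior, bary s' l x = 0 := by
    rw [hF, faceOpposite_closedInterior_eq_bary]
    exact fun x hx => hx.1
  obtain ⟨c, hg, hc⟩ := bary_eq_mul_of_facet_subset hFl
  refine ⟨c, ?_, hg⟩
  by_contra! hc0
  have hcpos : 0 < c := lt_of_le_of_ne hc0 fun h => baryGrad_ne_zero s' l (by
    rw [hg, ← h, zero_smul])
  obtain ⟨x, hxk, hx⟩ := exists_bary_facet_pos s k
  have hxF : x ∈ (s.faceOpposite k).closedInterior := by
    rw [faceOpposite_closedInterior_eq_bary]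
    refine ⟨hxk, fun j => ?_⟩
    by_cases hj : j = k
    · rw [hj, hxk]
    · exact (hx j hj).le
  have hsub : (s.faceOpposite k).closedInterior ⊆ s'.closedInterior :=
    hF ▸ facet_subset_closedInterior s' l
  have hpos : ∀ m, m ≠ l → 0 < bary s' m x := by
    intro m hm
    refine lt_of_le_of_ne ?_ fun h => hm ?_
    · have := hsub hxF
      rw [closedInterior_eq_bary] at this
      exact this m
    · exact eq_of_facet_subset (bary_eq_zero_on_facet hxk hx hsub h.symm) hFl
  -- If the factor were positive, moving from the facet's centroid towards vertex `k` of `s` would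
  -- stay in both simplices for a short time while leaving the facet.
  let z : ℝ → Pt d := fun t => AffineMap.lineMap x (s.points k) t
  have hz : Continuous z := AffineMap.lineMap_continuous
  have hz0 : z 0 = x := AffineMap.lineMap_apply_zero _ _
  have hzk : ∀ t, bary s k (z t) = t := by
    intro t
    simp only [z]
    rw [AffineMap.apply_lineMap, hxk, bary_points, if_pos rfl]
    simp [AffineMap.lineMap_apply]
  have hev : ∀ᶠ t in 𝓝[>] (0 : ℝ), ∀ m, m ≠ l → 0 < bary s' m (z t) := by
    rw [Filter.eventually_all]
    intro m
    by_cases hm : m = l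
    · simp [hm]
    · have h1 : Tendsto (fun t => bary s' m (z t)) (𝓝 0) (𝓝 (bary s' m x)) := by
        have := ((continuous_bary s' m).comp hz).tendsto 0
        simpa [hz0, Function.comp_def] using this
      filter_upwards [nhdsWithin_le_nhds (h1.eventually_const_lt (hpos m hm))] with t ht _ using ht
  have hev1 : ∀ᶠ t in 𝓝[>] (0 : ℝ), t ∈ Ioo (0 : ℝ) 1 := Ioo_mem_nhdsGT one_pos
  obtain ⟨t, ht, ht1⟩ := (hev.and hev1).exists
  have hzs : z t ∈ s.closedInterior := by
    have hconv : Convex ℝ s.closedInterior := by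
      rw [← s.convexHull_eq_closedInterior]
      exact convex_convexHull ℝ _
    exact hconv.lineMap_mem (facet_subset_closedInterior s k hxF)
      (s.point_mem_closedInterior k) ⟨ht1.1.le, ht1.2.le⟩
  have hzs' : z t ∈ s'.closedInterior := by
    rw [closedInterior_eq_bary]
    intro m
    by_cases hm : m = l
    · rw [hm, hc, hzk]
      exact mul_nonneg hc0 ht1.1.le
    · exact (ht m hm).le
  have := hinter ⟨hzs, hzs'⟩
  rw [faceOpposite_closedInterior_eq_bary] at this
  rw [Set.mem_ofPred_eq, hzk] at this
  exact ht1.1.ne' this.1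

omit [NeZero d] in
lemma normalize_neg_smul {g : Pt d} {c : ℝ} (hc : c < 0) :
    -(‖c • g‖⁻¹ • (c • g)) = ‖g‖⁻¹ • g := by
  rw [norm_smul, Real.norm_eq_abs, abs_of_neg hc, smul_smul, ← neg_smul]
  congr 1
  have := hc.ne
  by_cases hg : ‖g‖ = 0
  · simp [hg]
  · field_simp

end SharedFacets

/-! ### Interfaces of a conforming triangulation -/

namespace Triangulation

open Affine Filter Topology

variable {d : ℕ} [NeZero d] {Ω : Set (Pt d)} {N : ℕ} (M : Triangulation d Ω N)

lemma normal_eq (i : Fin N) (k : Fin (d + 1)) :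
    M.normal i k = -(‖baryGrad (M.elem i) k‖⁻¹ • baryGrad (M.elem i) k) :=
  normalized_altitude (M.elem i) k

lemma facet_eq_convexHull (i : Fin N) (k : Fin (d + 1)) :
    M.facet i k = convexHull ℝ ((M.elem i).points '' {k}ᶜ) :=
  faceOpposite_closedInterior (M.elem i) k

lemma facet_eq_bary (i : Fin N) (k : Fin (d + 1)) :
    M.facet i k = {x | bary (M.elem i) k x = 0 ∧ ∀ j, 0 ≤ bary (M.elem i) j x} :=
  faceOpposite_closedInterior_eq_bary (M.elem i) k

/-- A closed element is not covered by another element. -/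
lemma inter_ne_left {i j : Fin N} (hij : i ≠ j) :
    (M.elem i).closedInterior ∩ (M.elem j).closedInterior ≠ (M.elem i).closedInterior := by
  intro h
  obtain ⟨-, S', -, hS'⟩ := M.conforming i j
  rw [h] at hS'
  -- If `S'` missed a vertex `l`, coordinate `l` of element `j` would vanish at all vertices of
  -- element `i`, hence everywhere, although it is 1 at vertex `l`.
  have huniv : S' = univ := by
    by_contra hne
    obtain ⟨l, hl⟩ := (ne_univ_iff_exists_notMem _).1 hne
    have hz : ∀ m, bary (M.elem j) l ((M.elem i).points m) = 0 := fun m =>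
      bary_eq_zero_of_mem_convexHull (M.elem j)
        (hS' ▸ (M.elem i).point_mem_closedInterior m) hl
    have := affine_apply_eq_sum (M.elem i) (bary (M.elem j) l) ((M.elem j).points l)
    simp [hz, bary_points] at this
  rw [huniv, image_univ, Simplex.convexHull_eq_closedInterior] at hS'
  refine hij (M.elem_injective ?_)
  change (M.elem i).interior = (M.elem j).interior
  rw [simplex_interior_eq, simplex_interior_eq, hS']

/-- Two distinct elements which share a point in the relative interior of a facet of the first
share this facet, and nothing else. -/
lemma exists_common_facet {i j : Fin N} (hij : i ≠ j) {k : Fin (d + 1)} {x : Pt d}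
    (hxj : x ∈ (M.elem j).closedInterior) (hxk : bary (M.elem i) k x = 0)
    (hx : ∀ m, m ≠ k → 0 < bary (M.elem i) m x) :
    (M.elem i).closedInterior ∩ (M.elem j).closedInterior = M.facet i k ∧
      ∃ l, M.facet i k = M.facet j l := by
  have hxi : x ∈ (M.elem i).closedInterior := by
    rw [closedInterior_eq_bary]
    intro m
    by_cases hm : m = k
    · rw [hm, hxk]
    · exact (hx m hm).le
  obtain ⟨S, S', hS, hS'⟩ := M.conforming i j
  -- The point `x` needs every vertex other than `k` with positive weight. Including `k` as well
  -- would put the whole element `i` inside element `j`.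
  have hkS : {k}ᶜ ⊆ S := by
    intro m hm
    by_contra hmS
    exact (hx m hm).ne' (bary_eq_zero_of_mem_convexHull (M.elem i) (hS ▸ ⟨hxi, hxj⟩) hmS)
  have hSk : S = {k}ᶜ := by
    refine Subset.antisymm ?_ hkS
    rintro m hm rfl
    have : S = univ := eq_univ_of_forall fun a => by
      by_cases ha : a = m
      · exact ha ▸ hm
      · exact hkS ha
    refine M.inter_ne_left hij ?_
    rw [hS, this, image_univ, Simplex.convexHull_eq_closedInterior]
  rw [hSk, ← facet_eq_convexHull] at hS
  refine ⟨hS, ?_⟩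
  have hne : S' ≠ univ := by
    intro h
    rw [h, image_univ, Simplex.convexHull_eq_closedInterior, inter_comm] at hS'
    exact M.inter_ne_left hij.symm hS'
  obtain ⟨l, hl⟩ := (ne_univ_iff_exists_notMem _).1 hne
  rw [hS] at hS'
  have hzero : ∀ m ∉ S', ∀ y ∈ ((M.elem i).faceOpposite k).closedInterior,
      bary (M.elem j) m y = 0 := by
    intro m hm y hy
    change y ∈ M.facet i k at hy
    exact bary_eq_zero_of_mem_convexHull (M.elem j) (hS' ▸ hy) hm
  refine ⟨l, ?_⟩
  -- Each vertex outside `S'` gives a coordinate of element `j` vanishing on the facet; by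
  -- `eq_of_facet_subset` there is only one such vertex.
  have : S' = {l}ᶜ := by
    ext m
    rw [mem_compl_singleton_iff]
    refine ⟨fun hm h => hl (h ▸ hm), fun hm => ?_⟩
    by_contra hmS
    exact hm (eq_of_facet_subset (hzero m hmS) (hzero l hl))
  rw [hS', this, ← facet_eq_convexHull]

lemma inter_eq_facet {i j : Fin N} (hij : i ≠ j) {k l : Fin (d + 1)}
    (h : M.facet i k = M.facet j l) :
    (M.elem i).closedInterior ∩ (M.elem j).closedInterior = M.facet i k := by
  obtain ⟨x, hxk, hx⟩ := exists_bary_facet_pos (M.elem i) k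
  have hxF : x ∈ M.facet i k := by
    rw [facet_eq_bary]
    refine ⟨hxk, fun m => ?_⟩
    by_cases hm : m = k
    · rw [hm, hxk]
    · exact (hx m hm).le
  rw [h] at hxF
  exact (M.exists_common_facet hij (facet_subset_closedInterior (M.elem j) l hxF) hxk hx).1

/-- The outward normals on a common facet are opposite. -/
lemma normal_eq_neg {i j : Fin N} (hij : i ≠ j) {k l : Fin (d + 1)}
    (h : M.facet i k = M.facet j l) : M.normal j l = -M.normal i k := by
  obtain ⟨c, hc, hg⟩ := baryGrad_of_common_facet (s := M.elem i) (s' := M.elem j) h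
    (M.inter_eq_facet hij h).le
  rw [normal_eq, normal_eq, hg, neg_neg, normalize_neg_smul hc]

lemma normal_ne_zero (i : Fin N) (k : Fin (d + 1)) : M.normal i k ≠ 0 := by
  have := baryGrad_ne_zero (M.elem i) k
  simp [normal_eq, this]

lemma facet_injective (i : Fin N) : Function.Injective (M.facet i) := by
  intro k l h
  have hz : ∀ m, M.facet i k = M.facet i m →
      ∀ x ∈ ((M.elem i).faceOpposite k).closedInterior, bary (M.elem i) m x = 0 := by
    intro m hm x hx
    change x ∈ M.facet i k at hx
    rw [hm, facet_eq_bary] at hx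
    exact hx.1
  exact eq_of_facet_subset (hz k rfl) (hz l h)

/-- At most one facet of the other elements agrees with a given facet. -/
lemma common_facet_unique {i : Fin N} {k : Fin (d + 1)} {f g : Fin N × Fin (d + 1)}
    (hf : i ≠ f.1) (hg : i ≠ g.1) (h : M.facet i k = M.facet f.1 f.2)
    (h' : M.facet i k = M.facet g.1 g.2) : f = g := by
  have hfg : f.1 = g.1 := by
    by_contra hne
    -- Three distinct elements on one facet would have pairwise opposite normals, forcing $n=-n$.
    have h1 := M.normal_eq_neg hf h
    have h2 := M.normal_eq_neg hg h'
    have h3 := M.normal_eq_neg hne (h.symm.trans h')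
    rw [h1, h2, neg_neg, neg_eq_iff_add_eq_zero, ← two_smul ℝ, smul_eq_zero] at h3
    exact M.normal_ne_zero i k (h3.resolve_left two_ne_zero)
  obtain ⟨f1, f2⟩ := f
  obtain ⟨g1, g2⟩ := g
  dsimp only at *
  subst hfg
  rw [M.facet_injective _ (h.symm.trans h')]

omit [NeZero d] in
lemma closedInterior_subset (i : Fin N) : (M.elem i).closedInterior ⊆ closure Ω :=
  M.iUnion_eq ▸ subset_iUnion (fun i => (M.elem i).closedInterior) i

/-- A facet which does not lie on `∂Ω` is shared with another element. -/
lemma exists_neighbor (hΩ : interior (closure Ω) = Ω) {i : Fin N} {k : Fin (d + 1)}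
    (h : ¬ M.facet i k ⊆ frontier Ω) :
    ∃ f : Fin N × Fin (d + 1), i ≠ f.1 ∧ M.facet i k = M.facet f.1 f.2 := by
  have hopen : IsOpen Ω := hΩ ▸ isOpen_interior
  obtain ⟨x₀, hx₀F, hx₀⟩ := not_subset.1 h
  have hx₀Ω : x₀ ∈ Ω := by
    rw [hopen.frontier_eq] at hx₀
    by_contra hn
    exact hx₀ ⟨M.closedInterior_subset i (facet_subset_closedInterior _ k hx₀F), hn⟩
  obtain ⟨y, hyk, hy⟩ := exists_bary_facet_pos (M.elem i) k
  rw [facet_eq_bary] at hx₀F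
  -- The point `x₀` may lie on the rim of the facet. A short move towards the centroid reaches the
  -- relative interior and remains in the open set `Ω`.
  let z : ℝ → Pt d := fun t => AffineMap.lineMap x₀ y t
  have hz : Continuous z := AffineMap.lineMap_continuous
  have hz0 : z 0 = x₀ := AffineMap.lineMap_apply_zero _ _
  have hev : ∀ᶠ t in 𝓝[>] (0 : ℝ), z t ∈ Ω :=
    nhdsWithin_le_nhds ((hz.tendsto 0).eventually (by
      rw [hz0]
      exact hopen.mem_nhds hx₀Ω))
  have hev1 : ∀ᶠ t in 𝓝[>] (0 : ℝ), t ∈ Ioo (0 : ℝ) 1 := Ioo_mem_nhdsGT one_pos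
  obtain ⟨t, htΩ, ht⟩ := (hev.and hev1).exists
  have hb : ∀ m, bary (M.elem i) m (z t)
      = (1 - t) * bary (M.elem i) m x₀ + t * bary (M.elem i) m y := by
    intro m
    simp only [z]
    rw [AffineMap.apply_lineMap, AffineMap.lineMap_apply_ring]
  set x := z t
  have hxk : bary (M.elem i) k x = 0 := by rw [hb, hx₀F.1, hyk]; simp
  have hx : ∀ m, m ≠ k → 0 < bary (M.elem i) m x := fun m hm => by
    rw [hb]
    exact add_pos_of_nonneg_of_pos (mul_nonneg (by linarith [ht.2]) (hx₀F.2 m))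
      (mul_pos ht.1 (hy m hm))
  -- Thus `x` is a limit of points of `Ω` outside element `i`. The other elements cover those
  -- points, and their finite union is closed, so it contains `x`.
  have hclos : x ∈ closure (M.elem i).closedInteriorᶜ := by
    rw [closure_compl, mem_compl_iff, interior_closedInterior]
    exact fun hmem => (hmem k).ne' hxk
  have hT : IsClosed (⋃ j ∈ {j : Fin N | i ≠ j}, (M.elem j).closedInterior) :=
    (Set.toFinite _).isClosed_biUnion fun j _ => (M.elem j).isClosed_closedInterior
  have hsub : Ω ∩ (M.elem i).closedInteriorᶜ ⊆
      ⋃ j ∈ {j : Fin N | i ≠ j}, (M.elem j).closedInterior := by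
    rintro w ⟨hwΩ, hwi⟩
    have := subset_closure hwΩ
    rw [← M.iUnion_eq, mem_iUnion] at this
    obtain ⟨j, hj⟩ := this
    exact mem_biUnion (x := j) (fun hij => hwi (hij ▸ hj)) hj
  have hxT := closure_minimal hsub hT (hopen.inter_closure ⟨htΩ, hclos⟩)
  simp only [mem_iUnion] at hxT
  obtain ⟨j, hij, hxj⟩ := hxT
  obtain ⟨-, l, hl⟩ := M.exists_common_facet hij hxj hxk hx
  exact ⟨(j, l), hij, hl⟩

open Classical in
/-- Summation over all facets of all elements, sorted by interfaces. -/
lemma sum_facets_eq_sum_skeleton (hΩ : interior (closure Ω) = Ω)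
    (I : Fin N × Fin (d + 1) → ℝ) (hI : ∀ f ∈ M.boundaryFacets, I f = 0) :
    ∑ f, I f = ∑ e ∈ M.skeleton, (I e.1 + I e.2) := by
  -- Each interface occurs in `E` in both orders. Projection to the first side is a bijection onto
  -- the facets off `∂Ω`; swapping the sides identifies the half with `j < i` with the skeleton.
  let E : Finset (Side d N) := Finset.univ.filter fun e => e.1.1 ≠ e.2.1 ∧
    M.facet e.1.1 e.1.2 = M.facet e.2.1 e.2.2 ∧ ¬ M.facet e.1.1 e.1.2 ⊆ frontier Ω
  have h1 : ∑ f, I f = ∑ e ∈ E, I e.1 := by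
    rw [← Finset.sum_filter_add_sum_filter_not Finset.univ
      (fun f : Fin N × Fin (d + 1) => M.facet f.1 f.2 ⊆ frontier Ω),
      Finset.sum_eq_zero (s := Finset.univ.filter _), zero_add]
    · symm
      refine Finset.sum_nbij (fun e => e.1) ?_ ?_ ?_ fun _ _ => rfl
      · intro e he
        simp only [E, Finset.mem_filter, Finset.mem_univ, true_and] at he ⊢
        exact he.2.2
      · intro e he e' he' hee
        simp only [E, Finset.coe_filter, Finset.mem_univ, true_and, mem_ofPred_eq] at he he'
        dsimp only at hee
        refine Prod.ext hee ?_
        rw [← hee] at he'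
        exact M.common_facet_unique he.1 he'.1 he.2.1 he'.2.1
      · intro f hf
        simp only [Finset.coe_filter, Finset.mem_univ, true_and, mem_ofPred_eq] at hf
        obtain ⟨g, hg, hfg⟩ := M.exists_neighbor hΩ hf
        exact ⟨(f, g), by simpa [E] using ⟨hg, hfg, hf⟩, rfl⟩
    · intro f hf
      exact hI f (by simpa [boundaryFacets] using hf)
  have h2 : E.filter (fun e => e.1.1 < e.2.1) = M.skeleton := by
    ext e
    simp only [E, skeleton, Finset.mem_filter, Finset.mem_univ, true_and]
    constructor
    · exact fun h => ⟨h.2, h.1.2⟩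
    · exact fun h => ⟨⟨h.1.ne, h.2⟩, h.1⟩
  rw [h1, ← Finset.sum_filter_add_sum_filter_not E (fun e => e.1.1 < e.2.1), h2,
    Finset.sum_add_distrib]
  congr 1
  refine Finset.sum_nbij' Prod.swap Prod.swap ?_ ?_ (fun _ _ => rfl) (fun _ _ => rfl)
    fun _ _ => rfl
  · intro e he
    simp only [E, skeleton, Finset.mem_filter, Finset.mem_univ, true_and] at he ⊢
    exact ⟨lt_of_le_of_ne (not_lt.1 he.2) he.1.1.symm, he.1.2.1.symm, he.1.2.1 ▸ he.1.2.2⟩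
  · intro e he
    simp only [E, skeleton, Finset.mem_filter, Finset.mem_univ, true_and] at he ⊢
    exact ⟨⟨he.1.ne', he.2.1.symm, he.2.1 ▸ he.2.2⟩, not_lt.2 he.1.le⟩

end Triangulation

/-! ### Elementwise operators and product rules -/

section BrokenCalculus

variable {d N : ℕ}

lemma inner_bgrad {u : Fin N → Pt d → ℝ} (i : Fin N) (x e : Pt d) :
    inner ℝ (bgrad u i x) e = fderiv ℝ (u i) x e := by
  simp [bgrad, gradient]

lemma continuous_bgrad {u : Fin N → Pt d → ℝ} (hu : ∀ i, ContDiff ℝ 1 (u i)) (i : Fin N) :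
    Continuous (bgrad u i) :=
  (InnerProductSpace.toDual ℝ (Pt d)).symm.continuous.comp
    ((hu i).continuous_fderiv one_ne_zero)

lemma bdiv_eq_sum (w : Fin N → Pt d → Pt d) (i : Fin N) (x : Pt d) :
    bdiv w i x = ∑ l, fderiv ℝ (w i) x (EuclideanSpace.single l 1) l := rfl

lemma continuous_bdiv {w : Fin N → Pt d → Pt d} (hw : ∀ i, ContDiff ℝ 1 (w i)) (i : Fin N) :
    Continuous (bdiv w i) := by
  rw [show bdiv w i = _ from funext (bdiv_eq_sum w i)]
  refine continuous_finsetSum _ fun l _ => ?_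
  exact (EuclideanSpace.proj l : Pt d →L[ℝ] ℝ).continuous.comp
    (((hw i).continuous_fderiv one_ne_zero).clm_apply continuous_const)

lemma sum_inner_single (w n : Pt d) :
    ∑ l, inner ℝ n (EuclideanSpace.single l (1 : ℝ)) * w l = inner ℝ w n := by
  rw [PiLp.inner_apply]
  simp [EuclideanSpace.inner_single_right]

lemma bdiv_smul {u : Fin N → Pt d → ℝ} {w : Fin N → Pt d → Pt d}
    (hu : ∀ i, ContDiff ℝ 1 (u i)) (hw : ∀ i, ContDiff ℝ 1 (w i)) (i : Fin N) (x : Pt d) :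
    bdiv (fun j y => u j y • w j y) i x
      = inner ℝ (bgrad u i x) (w i x) + u i x * bdiv w i x := by
  have h := ((hu i).differentiable one_ne_zero x).hasFDerivAt.smul
    ((hw i).differentiable one_ne_zero x).hasFDerivAt
  rw [bdiv_eq_sum, bdiv_eq_sum, real_inner_comm (w i x), ← sum_inner_single, Finset.mul_sum, ← Finset.sum_add_distrib]
  refine Finset.sum_congr rfl fun l _ => ?_
  have h' : fderiv ℝ (fun y => u i y • w i y) x = _ := h.fderiv
  rw [h', inner_bgrad]
  simp
  ring

lemma bgrad_normSq {v : Fin N → Pt d → Pt d} (hv : ∀ i, ContDiff ℝ 1 (v i)) (i : Fin N)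
    (x e : Pt d) : inner ℝ (bgrad (fun j y => ‖v j y‖ ^ 2) i x) e
      = 2 * inner ℝ (fderiv ℝ (v i) x e) (v i x) := by
  have h := ((hv i).differentiable one_ne_zero x).hasFDerivAt.norm_sq
  rw [inner_bgrad, h.fderiv]
  simp [real_inner_comm]

lemma frob_tensor (a b c e : Pt d) :
    frob (tensor a b) (tensor c e) = inner ℝ a c * inner ℝ b e := by
  simp only [frob, tensor, Matrix.of_apply, PiLp.inner_apply, Finset.sum_mul_sum]
  refine Finset.sum_congr rfl fun k _ => Finset.sum_congr rfl fun l _ => ?_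
  simp
  ring

lemma frob_add_right (A B C : Matrix (Fin d) (Fin d) ℝ) :
    frob A (B + C) = frob A B + frob A C := by
  simp [frob, mul_add, Finset.sum_add_distrib]

end BrokenCalculus

/-! ### Integration by parts for broken functions -/

section SimplexDivergence

variable {d : ℕ} [NeZero d] {Ω : Set (Pt d)} {N : ℕ} (M : Triangulation d Ω N)

namespace Triangulation

lemma integrableOn_facet (i : Fin N) (k : Fin (d + 1)) {f : Pt d → ℝ} (hf : Continuous f) :
    IntegrableOn f (M.facet i k) (μHE[d - 1]) :=
  QuasiIncompressible.integrableOn_facet (M.elem i) k hf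

omit [NeZero d] in
lemma integrableOn_elem (i : Fin N) {f : Pt d → ℝ} (hf : Continuous f) :
    IntegrableOn f (M.elem i).interior :=
  (hf.continuousOn.integrableOn_compact (M.elem i).isCompact_closedInterior).mono_set
    (M.elem i).interior_subset_closedInterior

/-- The divergence theorem on an element. -/
lemma integral_bdiv {w : Fin N → Pt d → Pt d} (hw : ∀ i, ContDiff ℝ 1 (w i)) (i : Fin N) :
    ∫ x in (M.elem i).interior, bdiv w i x =
      ∑ k, ∫ x in M.facet i k, inner ℝ (w i x) (M.normal i k) ∂μHE[d - 1] := by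
  have hwl : ∀ l, ContDiff ℝ 1 fun x => w i x l := fun l =>
    (EuclideanSpace.proj l : Pt d →L[ℝ] ℝ).contDiff.comp (hw i)
  have hder : ∀ l x, fderiv ℝ (w i) x (EuclideanSpace.single l 1) l
      = fderiv ℝ (fun x => w i x l) x (EuclideanSpace.single l 1) := by
    intro l x
    have h : HasFDerivAt (fun x => w i x l) _ x :=
      (EuclideanSpace.proj l : Pt d →L[ℝ] ℝ).hasFDerivAt.comp x
        ((hw i).differentiable one_ne_zero x).hasFDerivAt
    rw [h.fderiv]
    simp
  simp_rw [bdiv_eq_sum, hder]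
  rw [integral_finsetSum]
  · simp_rw [integral_interior_fderiv (M.elem i) (hwl _), ← normal_eq]
    rw [Finset.sum_comm]
    refine Finset.sum_congr rfl fun k _ => ?_
    have hsum := fun x => (sum_inner_single (w i x) (M.normal i k)).symm
    simp_rw [← integral_const_mul, hsum]
    rw [integral_finsetSum]
    · rfl
    · exact fun l _ => M.integrableOn_facet i k ((hwl l).continuous.const_mul _)
  · exact fun l _ => M.integrableOn_elem i
      (((hwl l).continuous_fderiv one_ne_zero).clm_apply continuous_const)

omit [NeZero d] in
lemma intDomain_add {f g : Fin N → Pt d → ℝ} (hf : ∀ i, Continuous (f i))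
    (hg : ∀ i, Continuous (g i)) :
    M.intDomain (fun i x => f i x + g i x) = M.intDomain f + M.intDomain g := by
  simp only [intDomain]
  rw [← Finset.sum_add_distrib]
  exact Finset.sum_congr rfl fun i _ =>
    integral_add (M.integrableOn_elem i (hf i)) (M.integrableOn_elem i (hg i))

omit [NeZero d] in
lemma intDomain_const_mul (c : ℝ) (f : Fin N → Pt d → ℝ) :
    M.intDomain (fun i x => c * f i x) = c * M.intDomain f := by
  simp only [intDomain, integral_const_mul, Finset.mul_sum]

omit [NeZero d] in
lemma intDomain_sub {f g : Fin N → Pt d → ℝ} (hf : ∀ i, Continuous (f i))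
    (hg : ∀ i, Continuous (g i)) :
    M.intDomain (fun i x => f i x - g i x) = M.intDomain f - M.intDomain g := by
  simp only [intDomain]
  rw [← Finset.sum_sub_distrib]
  exact Finset.sum_congr rfl fun i _ =>
    integral_sub (M.integrableOn_elem i (hf i)) (M.integrableOn_elem i (hg i))

lemma intSkeleton_congr {f g : Side d N → Pt d → ℝ} (h : ∀ e ∈ M.skeleton, ∀ x, f e x = g e x) :
    M.intSkeleton f = M.intSkeleton g :=
  Finset.sum_congr rfl fun e he => by rw [funext (h e he)]

lemma intSkeleton_add {f g : Side d N → Pt d → ℝ} (hf : ∀ e, Continuous (f e))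
    (hg : ∀ e, Continuous (g e)) :
    M.intSkeleton (fun e x => f e x + g e x) = M.intSkeleton f + M.intSkeleton g := by
  simp only [intSkeleton]
  rw [← Finset.sum_add_distrib]
  exact Finset.sum_congr rfl fun e _ =>
    integral_add (M.integrableOn_facet _ _ (hf e)) (M.integrableOn_facet _ _ (hg e))

lemma intSkeleton_sub {f g : Side d N → Pt d → ℝ} (hf : ∀ e, Continuous (f e))
    (hg : ∀ e, Continuous (g e)) :
    M.intSkeleton (fun e x => f e x - g e x) = M.intSkeleton f - M.intSkeleton g := by
  simp only [intSkeleton]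
  rw [← Finset.sum_sub_distrib]
  exact Finset.sum_congr rfl fun e _ =>
    integral_sub (M.integrableOn_facet _ _ (hf e)) (M.integrableOn_facet _ _ (hg e))

lemma intSkeleton_const_mul (c : ℝ) (f : Side d N → Pt d → ℝ) :
    M.intSkeleton (fun e x => c * f e x) = c * M.intSkeleton f := by
  simp only [intSkeleton, integral_const_mul, Finset.mul_sum]

lemma normal_snd {e : Side d N} (he : e ∈ M.skeleton) :
    M.normal e.2.1 e.2.2 = -M.normal e.1.1 e.1.2 := by
  simp only [skeleton, Finset.mem_filter, Finset.mem_univ, true_and] at he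
  exact M.normal_eq_neg he.1.ne he.2.1

lemma facet_snd {e : Side d N} (he : e ∈ M.skeleton) :
    M.facet e.1.1 e.1.2 = M.facet e.2.1 e.2.2 := by
  simp only [skeleton, Finset.mem_filter, Finset.mem_univ, true_and] at he
  exact he.2.1

lemma continuous_jump {u : Fin N → Pt d → ℝ} (hu : ∀ i, Continuous (u i)) (e : Side d N) :
    Continuous (M.jump u e) := by
  unfold jump
  fun_prop

lemma continuous_vjump {w : Fin N → Pt d → Pt d} (hw : ∀ i, Continuous (w i)) (e : Side d N) :
    Continuous (M.vjump w e) := by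
  unfold vjump
  fun_prop

omit [NeZero d] in
lemma continuous_avg {V : Type*} [NormedAddCommGroup V] [NormedSpace ℝ V]
    {u : Fin N → Pt d → V} (hu : ∀ i, Continuous (u i)) (e : Side d N) :
    Continuous (avg u e) := by
  unfold avg
  fun_prop

lemma continuous_inner_jump_avg {u : Fin N → Pt d → ℝ} {w : Fin N → Pt d → Pt d}
    (hu : ∀ i, Continuous (u i)) (hw : ∀ i, Continuous (w i)) (e : Side d N) :
    Continuous fun x => inner ℝ (M.jump u e x) (avg w e x) :=
  (M.continuous_jump hu e).inner (continuous_avg hw e)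

lemma continuous_vjump_mul_avg {u : Fin N → Pt d → ℝ} {w : Fin N → Pt d → Pt d}
    (hu : ∀ i, Continuous (u i)) (hw : ∀ i, Continuous (w i)) (e : Side d N) :
    Continuous fun x => M.vjump w e x * avg u e x :=
  (M.continuous_vjump hw e).mul (continuous_avg hu e)

/-- Broken integration by parts. -/
theorem integration_by_parts (hΩ : interior (closure Ω) = Ω)
    {u : Fin N → Pt d → ℝ} {w : Fin N → Pt d → Pt d}
    (hu : ∀ i, ContDiff ℝ 1 (u i)) (hw : ∀ i, ContDiff ℝ 1 (w i))
    (hbd : ∀ f ∈ M.boundaryFacets, ∀ x ∈ M.facet f.1 f.2,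
      inner ℝ (w f.1 x) (M.normal f.1 f.2) = 0) :
    M.intDomain (fun i x => inner ℝ (bgrad u i x) (w i x))
        + M.intDomain (fun i x => bdiv w i x * u i x) =
      M.intSkeleton (fun e x => inner ℝ (M.jump u e x) (avg w e x))
        + M.intSkeleton (fun e x => M.vjump w e x * avg u e x) := by
  have huc := fun i => (hu i).continuous
  have hwc := fun i => (hw i).continuous
  rw [← M.intDomain_add (fun i => (continuous_bgrad hu i).inner (hwc i))
      (show ∀ i, Continuous fun x => bdiv w i x * u i x from
        fun i => (continuous_bdiv hw i).mul (huc i)),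
    ← M.intSkeleton_add (M.continuous_inner_jump_avg huc hwc)
      (M.continuous_vjump_mul_avg huc hwc)]
  have huw : ∀ i, ContDiff ℝ 1 fun x => u i x • w i x := fun i => (hu i).smul (hw i)
  let I : Fin N × Fin (d + 1) → ℝ := fun f =>
    ∫ x in M.facet f.1 f.2, inner ℝ (u f.1 x • w f.1 x) (M.normal f.1 f.2) ∂μHE[d - 1]
  have h1 : M.intDomain (fun i x => inner ℝ (bgrad u i x) (w i x) + bdiv w i x * u i x)
      = ∑ f, I f := by
    rw [Fintype.sum_prod_type]
    refine Finset.sum_congr rfl fun i _ => ?_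
    rw [← M.integral_bdiv huw i]
    congr 1
    ext x
    rw [bdiv_smul hu hw, mul_comm (u i x)]
  have hmeas : ∀ i k, MeasurableSet (M.facet i k) := fun i k =>
    (isCompact_facet (M.elem i) k).measurableSet
  rw [h1, M.sum_facets_eq_sum_skeleton hΩ I]
  · refine Finset.sum_congr rfl fun e he => ?_
    simp only [I]
    rw [← M.facet_snd he, M.normal_snd he, ← integral_add]
    -- With $n$ the normal of the first side, this is $(u_1w_1-u_2w_2)\cdot
    -- n=[u]\cdot\{w\}+[w]\{u\}$.
    · congr 1
      ext x
      simp only [jump, vjump, avg, M.normal_snd he, inner_add_left, inner_add_right,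
        inner_smul_left, inner_smul_right, inner_neg_left, inner_neg_right, smul_neg,
        smul_eq_mul, real_inner_comm (M.normal e.1.1 e.1.2), RCLike.conj_to_real]
      ring
    · exact M.integrableOn_facet _ _ ((huw _).continuous.inner continuous_const)
    · exact M.integrableOn_facet _ _ ((huw _).continuous.inner continuous_const)
  · intro f hf
    refine setIntegral_eq_zero_of_forall_eq_zero fun x hx => ?_
    rw [inner_smul_left, hbd f hf x hx, mul_zero]

end Triangulation

end SimplexDivergence

/-! ### The energy balance at a fixed time -/

section StaticIdentity

open Triangulation

variable {d N : ℕ} [NeZero d] {Ω : Set (Pt d)} (M : Triangulation d Ω N) (P : Model)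

lemma Model.cPlus_pos : 0 < P.cPlus := by
  have := P.ρ₁_pos
  have := P.ρ₂_pos
  unfold Model.cPlus
  positivity

lemma Model.cMinus_mul : P.cMinus * (P.ρ₁ + P.ρ₂) = -(P.cPlus * (P.ρ₁ - P.ρ₂)) := by
  have := P.ρ₁_pos.ne'
  have := P.ρ₂_pos.ne'
  unfold Model.cPlus Model.cMinus
  field_simp
  ring

lemma continuous_rho : Continuous P.rho := by
  unfold Model.rho
  fun_prop

/-- The discrete gradient form `∫_Ω ∇φ·τ - ∫_ℰ [φ]·{τ}`. -/
def gradForm (φ : Fin N → Pt d → ℝ) (τ : Fin N → Pt d → Pt d) : ℝ :=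
  M.intDomain (fun i x => inner ℝ (bgrad φ i x) (τ i x))
    - M.intSkeleton (fun e x => inner ℝ (M.jump φ e x) (avg τ e x))

variable {M P} {φ φ' a b lam : Fin N → Pt d → ℝ} {v v' q : Fin N → Pt d → Pt d}

/-- This and the next four lemmas split each tested equation into separate integrals, so that the
balance reduces to linear algebra in their values. -/
lemma eq1_expand (hφ : ∀ i, ContDiff ℝ 1 (φ i)) (hφ' : ∀ i, ContDiff ℝ 1 (φ' i))
    (hv : ∀ i, ContDiff ℝ 1 (v i)) (ha : ∀ i, ContDiff ℝ 1 (a i))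
    (h : Eq1 M P φ φ' v a a) :
    0 = M.intDomain (fun i x => a i x * φ' i x)
      + M.intDomain (fun i x => bdiv (fun j y => φ j y • v j y) i x * a i x)
      + P.cPlus * (P.m_r * M.intDomain (fun i x => a i x * a i x))
      - P.cPlus * P.m_j * formA1 M P a a
      - M.intSkeleton (fun e x => M.vjump (fun j y => φ j y • v j y) e x * avg a e x) := by
  have hφv : ∀ i, ContDiff ℝ 1 fun y => φ i y • v i y := fun i => (hφ i).smul (hv i)
  have c1 := fun i => (hφ' i).continuous
  have c2 := fun i => (ha i).continuous
  have c3 := continuous_bdiv hφv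
  rw [← M.intDomain_const_mul, ← M.intDomain_const_mul, ← M.intDomain_add, ← M.intDomain_add]
  · refine h.trans ?_
    congr 3
    ext i x
    ring
  all_goals intro i; fun_prop

lemma eq2_expand (hφ : ∀ i, ContDiff ℝ 1 (φ i))
    (hv : ∀ i, ContDiff ℝ 1 (v i)) (hv' : ∀ i, Continuous (v' i))
    (ha : ∀ i, ContDiff ℝ 1 (a i)) (hb : ∀ i, ContDiff ℝ 1 (b i))
    (h : Eq2 M P φ v v' a b v) :
    0 = M.intDomain (fun i x => P.rho (φ i x) * inner ℝ (v' i x) (v i x))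
      + M.intDomain (fun i x => inner ℝ (bgrad b i x) (v i x))
      + 1 / P.cPlus * M.intDomain (fun i x =>
          inner ℝ (bgrad (fun j y => a j y - P.cMinus * b j y) i x) (φ i x • v i x))
      - P.η * formA2 M P v v
      - M.intSkeleton (fun e x => inner ℝ (M.jump b e x) (avg v e x))
      - 1 / P.cPlus * M.intSkeleton (fun e x =>
          inner ℝ (M.jump (fun j y => a j y - P.cMinus * b j y) e x)
            (avg (fun j y => φ j y • v j y) e x)) := by
  have c1 := fun i => (hφ i).continuous
  have c2 := fun i => (hv i).continuous
  have hab : ∀ i, ContDiff ℝ 1 fun y => a i y - P.cMinus * b i y := fun i =>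
    (ha i).sub (contDiff_const.mul (hb i))
  have c3 := continuous_bgrad hb
  have c4 := continuous_bgrad hab
  have c5 := continuous_rho P
  have hρ : ∀ i, Continuous fun x => P.rho (φ i x) := fun i => c5.comp (c1 i)
  have hφv : ∀ i, Continuous fun y => φ i y • v i y := fun i => (c1 i).smul (c2 i)
  have hsk : M.intSkeleton (fun e x =>
        - frob (tensor (avg v e x) (avg (fun j y => P.rho (φ j y) • v j y) e x))
            (M.tjump v e x)
        + 1 / 2 * inner ℝ (M.jump (fun j y => ‖v j y‖ ^ 2) e x)
            (avg (fun j y => P.rho (φ j y) • v j y) e x)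
        - inner ℝ (M.jump b e x) (avg v e x)
        - 1 / P.cPlus * inner ℝ (M.jump (fun j y => a j y - P.cMinus * b j y) e x)
            (avg (fun j y => φ j y • v j y) e x))
      = - M.intSkeleton (fun e x => inner ℝ (M.jump b e x) (avg v e x))
        - 1 / P.cPlus * M.intSkeleton (fun e x =>
          inner ℝ (M.jump (fun j y => a j y - P.cMinus * b j y) e x)
            (avg (fun j y => φ j y • v j y) e x)) := by
    rw [neg_eq_neg_one_mul, ← M.intSkeleton_const_mul, ← M.intSkeleton_const_mul,
      ← M.intSkeleton_sub]
    · refine M.intSkeleton_congr fun e he x => ?_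
      set m := avg (fun j y => P.rho (φ j y) • v j y) e x
      -- Both sides equal $\frac12(|v_1|^2-|v_2|^2)\,m\cdot n$, because
      -- $\{v\}\cdot(v_1-v_2)=\frac12(|v_1|^2-|v_2|^2)$. Hence the convective interface terms cancel
      -- pointwise.
      have h1 : frob (tensor (avg v e x) m) (M.tjump v e x)
          = 1 / 2 * inner ℝ (M.jump (fun j y => ‖v j y‖ ^ 2) e x) m := by
        simp only [tjump, frob_add_right, frob_tensor, jump, M.normal_snd he, inner_neg_right,
          inner_add_left, inner_smul_left, inner_neg_left, smul_neg,
          ← real_inner_self_eq_norm_sq, RCLike.conj_to_real,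
          real_inner_comm (M.normal e.1.1 e.1.2) m]
        simp only [avg, inner_add_left, inner_smul_left, RCLike.conj_to_real,
          real_inner_comm (v e.1.1 x) (v e.2.1 x)]
        ring
      rw [h1]
      ring
    · intro e
      exact (M.continuous_inner_jump_avg (fun i => (hb i).continuous) c2 e).const_mul _
    · intro e
      exact (M.continuous_inner_jump_avg (fun i => (hab i).continuous) hφv e).const_mul _
  refine h.trans ?_
  rw [hsk, ← M.intDomain_const_mul, ← M.intDomain_add, ← M.intDomain_add]
  · rw [show ∀ A B C D : ℝ, A - B + (-C - D) = A - B - C - D from fun _ _ _ _ => by ring]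
    congr 4
    ext i x
    rw [bgrad_normSq hv, inner_smul_right]
    ring
  all_goals intro i; fun_prop

lemma eq3_expand (hφ : ∀ i, ContDiff ℝ 1 (φ i)) (hφ' : ∀ i, ContDiff ℝ 1 (φ' i))
    (hv : ∀ i, ContDiff ℝ 1 (v i)) (hb : ∀ i, ContDiff ℝ 1 (b i))
    (h : Eq3 M P φ φ' v b) :
    0 = M.intDomain (fun i x => bdiv v i x * b i x)
      - P.cMinus / P.cPlus * M.intDomain (fun i x => b i x * φ' i x)
      - P.cMinus / P.cPlus * M.intDomain (fun i x =>
          bdiv (fun j y => φ j y • v j y) i x * b i x)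
      + P.cMinus / P.cPlus * M.intSkeleton (fun e x =>
          M.vjump (fun j y => φ j y • v j y) e x * avg b e x)
      - M.intSkeleton (fun e x => M.vjump v e x * avg b e x) := by
  have hφv : ∀ i, ContDiff ℝ 1 fun y => φ i y • v i y := fun i => (hφ i).smul (hv i)
  have c1 := fun i => (hφ' i).continuous
  have c2 := fun i => (hb i).continuous
  have c3 := continuous_bdiv hφv
  have c4 := continuous_bdiv hv
  have hsk : M.intSkeleton (fun e x =>
        M.vjump (fun j y => (P.cMinus / P.cPlus * φ j y) • v j y - v j y) e x * avg b e x)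
      = P.cMinus / P.cPlus * M.intSkeleton (fun e x =>
          M.vjump (fun j y => φ j y • v j y) e x * avg b e x)
      - M.intSkeleton (fun e x => M.vjump v e x * avg b e x) := by
    rw [← M.intSkeleton_const_mul, ← M.intSkeleton_sub]
    · refine M.intSkeleton_congr fun e _ x => ?_
      simp only [vjump, inner_sub_left, inner_smul_left, RCLike.conj_to_real]
      ring
    · exact fun e => (M.continuous_vjump_mul_avg c2 (fun i => (hφv i).continuous) e).const_mul _
    · exact M.continuous_vjump_mul_avg c2 (fun i => (hv i).continuous)
  refine h.trans ?_
  rw [hsk, add_sub_assoc, ← M.intDomain_const_mul, ← M.intDomain_const_mul,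
    ← M.intDomain_sub, ← M.intDomain_sub]
  · congr 2
    ext i x
    ring
  all_goals intro i; fun_prop

lemma eq4_expand (hφ : ∀ i, Continuous (φ i)) (hφ' : ∀ i, Continuous (φ' i))
    (ha : ∀ i, Continuous (a i)) (hlam : ∀ i, Continuous (lam i))
    (hq : ∀ i, ContDiff ℝ 1 (q i)) (h : Eq4 M P φ lam a q φ') :
    0 = M.intDomain (fun i x => a i x * φ' i x)
      - P.cPlus * M.intDomain (fun i x => deriv P.W (φ i x) * φ' i x)
      - P.cMinus * M.intDomain (fun i x => lam i x * φ' i x)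
      + P.cPlus * P.γ * M.intDomain (fun i x => bdiv q i x * φ' i x)
      - P.cPlus * P.γ * M.intSkeleton (fun e x => M.vjump q e x * avg φ' e x) := by
  have c4 := continuous_bdiv hq
  have hW : Continuous (deriv P.W) := P.W_contDiff.continuous_deriv le_rfl
  have c5 : ∀ i, Continuous fun x => deriv P.W (φ i x) := fun i => hW.comp (hφ i)
  refine h.trans ?_
  rw [← M.intDomain_const_mul, ← M.intDomain_const_mul, ← M.intDomain_const_mul,
    ← M.intDomain_sub, ← M.intDomain_sub, ← M.intDomain_add]
  · congr 2
    ext i x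
    ring
  all_goals intro i; fun_prop

omit [NeZero d] in
lemma eq5_expand (hφ' : ∀ i, Continuous (φ' i)) (hv : ∀ i, Continuous (v i))
    (hb : ∀ i, Continuous (b i)) (hlam : ∀ i, Continuous (lam i)) (h : Eq5 M P v lam b φ') :
    0 = M.intDomain (fun i x => b i x * φ' i x) - M.intDomain (fun i x => lam i x * φ' i x)
      - (P.ρ₁ + P.ρ₂) / 4 * M.intDomain (fun i x => ‖v i x‖ ^ 2 * φ' i x) := by
  refine h.trans ?_
  rw [← M.intDomain_const_mul, ← M.intDomain_sub, ← M.intDomain_sub]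
  · congr 1
    ext i x
    ring
  all_goals intro i; fun_prop

/-- The second equation contains the gradient of $a-c_-b$, whereas the first and third provide the
terms in $a$ and $b$ separately. -/
lemma sub_mul_expand (hφ : ∀ i, ContDiff ℝ 1 (φ i)) (hv : ∀ i, ContDiff ℝ 1 (v i))
    (ha : ∀ i, ContDiff ℝ 1 (a i)) (hb : ∀ i, ContDiff ℝ 1 (b i)) (c : ℝ) :
    M.intDomain (fun i x => bdiv (fun j y => φ j y • v j y) i x * (a i x - c * b i x))
        = M.intDomain (fun i x => bdiv (fun j y => φ j y • v j y) i x * a i x)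
          - c * M.intDomain (fun i x => bdiv (fun j y => φ j y • v j y) i x * b i x) ∧
      M.intSkeleton (fun e x => M.vjump (fun j y => φ j y • v j y) e x *
          avg (fun j y => a j y - c * b j y) e x)
        = M.intSkeleton (fun e x => M.vjump (fun j y => φ j y • v j y) e x * avg a e x)
          - c * M.intSkeleton (fun e x =>
              M.vjump (fun j y => φ j y • v j y) e x * avg b e x) := by
  have hφv : ∀ i, ContDiff ℝ 1 fun y => φ i y • v i y := fun i => (hφ i).smul (hv i)
  have c1 := fun i => (ha i).continuous
  have c2 := fun i => (hb i).continuous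
  have c3 := continuous_bdiv hφv
  have c4 := fun i => (hφv i).continuous
  constructor
  · rw [← M.intDomain_const_mul, ← M.intDomain_sub]
    · congr 1
      ext i x
      ring
    all_goals intro i; fun_prop
  · rw [← M.intSkeleton_const_mul, ← M.intSkeleton_sub]
    · refine M.intSkeleton_congr fun e _ x => ?_
      simp only [avg, smul_eq_mul]
      ring
    · exact M.continuous_vjump_mul_avg c1 c4
    · exact fun e => (M.continuous_vjump_mul_avg c2 c4 e).const_mul _

lemma energy_balance_algebra {c m r κ ρ₁ ρ₂ γ η m_r m_j Aa Ab Al AW Av Da Db Dvb Dq aa R G Gb Gab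
    S₁ S₁b S₂ S₃ S₄ S₅ S₆ A₁ A₂ : ℝ} (hr : c * r = 1) (hκ : c * κ = m)
    (hm : m * (ρ₁ + ρ₂) = -(c * (ρ₁ - ρ₂)))
    (e1 : 0 = Aa + Da + c * (m_r * aa) - c * m_j * A₁ - S₁)
    (e2 : 0 = R + Gb + r * Gab - η * A₂ - S₃ - r * S₄)
    (e3 : 0 = Dvb - κ * Ab - κ * Db + κ * S₁b - S₂)
    (e4 : 0 = Aa - c * AW - m * Al + c * γ * Dq - c * γ * S₅)
    (e5 : 0 = Ab - Al - (ρ₁ + ρ₂) / 4 * Av)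
    (i1 : G + Dq = S₆ + S₅) (i2 : Gb + Dvb = S₃ + S₂)
    (i3 : Gab + (Da - m * Db) = S₄ + (S₁ - m * S₁b)) :
    c * (AW + (ρ₁ - ρ₂) / 4 * Av + R + γ * (G - S₆))
      = c * (-(m_r * aa) + m_j * A₁ + η * A₂) := by
  linear_combination -e1 - c * e2 - c * e3 + e4 - m * e5 + c * γ * i1 - c * i2 - i3
    + Av / 4 * hm - (Gab - S₄) * hr + (Ab + Db - S₁b) * hκ

/-- The energy balance at a fixed time; `φ'`, `v'` stand for the time derivatives. -/
theorem energy_balance (hΩ : interior (closure Ω) = Ω)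
    (hφ : ∀ i, ContDiff ℝ 1 (φ i)) (hφ' : ∀ i, ContDiff ℝ 1 (φ' i))
    (hv : ∀ i, ContDiff ℝ 1 (v i)) (hv' : ∀ i, Continuous (v' i))
    (ha : ∀ i, ContDiff ℝ 1 (a i)) (hb : ∀ i, ContDiff ℝ 1 (b i))
    (hlam : ∀ i, Continuous (lam i)) (hq : ∀ i, ContDiff ℝ 1 (q i))
    (hv0 : ∀ f ∈ M.boundaryFacets, ∀ x ∈ M.facet f.1 f.2, v f.1 x = 0)
    (hqn : ∀ f ∈ M.boundaryFacets, ∀ x ∈ M.facet f.1 f.2,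
      inner ℝ (q f.1 x) (M.normal f.1 f.2) = 0)
    (h1 : Eq1 M P φ φ' v a a) (h2 : Eq2 M P φ v v' a b v) (h3 : Eq3 M P φ φ' v b)
    (h4 : Eq4 M P φ lam a q φ') (h5 : Eq5 M P v lam b φ') :
    M.intDomain (fun i x => deriv P.W (φ i x) * φ' i x)
      + (P.ρ₁ - P.ρ₂) / 4 * M.intDomain (fun i x => ‖v i x‖ ^ 2 * φ' i x)
      + M.intDomain (fun i x => P.rho (φ i x) * inner ℝ (v' i x) (v i x))
      + P.γ * gradForm M φ' q
    = - (P.m_r * M.intDomain (fun i x => a i x * a i x)) + P.m_j * formA1 M P a a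
      + P.η * formA2 M P v v := by
  have hφv : ∀ i, ContDiff ℝ 1 fun y => φ i y • v i y := fun i => (hφ i).smul (hv i)
  have hab : ∀ i, ContDiff ℝ 1 fun y => a i y - P.cMinus * b i y := fun i =>
    (ha i).sub (contDiff_const.mul (hb i))
  have e1 := eq1_expand hφ hφ' hv ha h1
  have e2 := eq2_expand hφ hv hv' ha hb h2
  have e3 := eq3_expand hφ hφ' hv hb h3
  have e4 := eq4_expand (fun i => (hφ i).continuous) (fun i => (hφ' i).continuous)
    (fun i => (ha i).continuous) hlam hq h4
  have e5 := eq5_expand (fun i => (hφ' i).continuous) (fun i => (hv i).continuous)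
    (fun i => (hb i).continuous) hlam h5
  have i1 := M.integration_by_parts hΩ hφ' hq hqn
  have i2 := M.integration_by_parts hΩ hb hv fun f hf x hx => by
    rw [hv0 f hf x hx, inner_zero_left]
  have i3 := M.integration_by_parts hΩ hab hφv fun f hf x hx => by
    simp only [hv0 f hf x hx, smul_zero, inner_zero_left]
  obtain ⟨s1, s2⟩ := sub_mul_expand (M := M) hφ hv ha hb P.cMinus
  rw [s1, s2] at i3
  have hc := P.cPlus_pos.ne'
  exact mul_left_cancel₀ hc (energy_balance_algebra (by field_simp) (by field_simp)
    P.cMinus_mul e1 e2 e3 e4 e5 i1 i2 i3)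

end StaticIdentity

/-! ### Differentiating an integral along a curve of parameters -/

section ParametricIntegral

open Topology Filter

/-- Finite dimension makes closed balls in `H` compact, so the parameter derivative is bounded on a
ball times `K`, which gives domination; the chain rule then follows the curve. Requiring only the
derivative of `F` along the line in direction `c'` spares the caller the Fréchet derivative. -/
lemma hasDerivWithinAt_setIntegral {H X : Type*} [NormedAddCommGroup H] [NormedSpace ℝ H]
    [FiniteDimensional ℝ H] [NormedAddCommGroup X] [NormedSpace ℝ X] [MeasurableSpace X]
    [OpensMeasurableSpace X] [SecondCountableTopology X] {μ : Measure X}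
    [IsFiniteMeasureOnCompacts μ] {F : H → X → ℝ} (hF : ContDiff ℝ 1 (Function.uncurry F))
    {K S : Set X} (hK : IsCompact K) (hSK : S ⊆ K) (hS : MeasurableSet S)
    {c : ℝ → H} {c' : H} {A : Set ℝ} {t : ℝ} (hc : HasDerivWithinAt c c' A t)
    {G : X → ℝ} (hG : ∀ x, HasDerivAt (fun r : ℝ => F (c t + r • c') x) (G x) 0) :
    HasDerivWithinAt (fun s => ∫ x in S, F (c s) x ∂μ) (∫ x in S, G x ∂μ) A t := by
  let F' : H → X → H →L[ℝ] ℝ := fun u x =>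
    (fderiv ℝ (Function.uncurry F) (u, x)).comp (ContinuousLinearMap.inl ℝ H X)
  have hF' : Continuous (Function.uncurry F') :=
    (hF.continuous_fderiv one_ne_zero).clm_comp continuous_const
  have hder : ∀ u x, HasFDerivAt (fun u => F u x) (F' u x) u := fun u x =>
    HasFDerivAt.comp (g := Function.uncurry F) (f := fun u => (u, x)) u
      (hF.differentiable one_ne_zero (u, x)).hasFDerivAt (hasFDerivAt_prodMk_left u x)
  have hFx : ∀ u, Continuous (F u) := fun u =>
    hF.continuous.comp (by fun_prop : Continuous fun x => (u, x))
  have hF'x : ∀ u, Continuous (F' u) := fun u => hF'.comp (by fun_prop : Continuous fun x => (u, x))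
  obtain ⟨C, hC⟩ := ((isCompact_closedBall (c t) 1).prod hK).exists_bound_of_continuousOn
    hF'.continuousOn
  have hfin : μ S < ⊤ := (measure_mono hSK).trans_lt hK.measure_lt_top
  have key : HasFDerivAt (fun u => ∫ x in S, F u x ∂μ) (∫ x in S, F' (c t) x ∂μ) (c t) := by
    refine hasFDerivAt_integral_of_dominated_of_fderiv_le (bound := fun _ => C)
      (Metric.closedBall_mem_nhds (c t) one_pos)
      (.of_forall fun u => (hFx u).aestronglyMeasurable)
      (((hFx (c t)).continuousOn.integrableOn_compact hK).mono_set hSK)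
      (hF'x (c t)).aestronglyMeasurable ?_ (integrableOn_const hfin.ne)
      (.of_forall fun x u _ => hder u x)
    exact (ae_restrict_iff' hS).2 (.of_forall fun x hx u hu => hC (u, x) ⟨hu, hSK hx⟩)
  have hcomp := key.comp_hasDerivWithinAt t hc
  have hint : IntegrableOn (F' (c t)) S μ :=
    ((hF'x (c t)).continuousOn.integrableOn_compact hK).mono_set hSK
  rw [ContinuousLinearMap.integral_apply hint] at hcomp
  have hGF : ∀ x, F' (c t) x c' = G x := by
    intro x
    have h1 : HasDerivAt (fun r : ℝ => c t + r • c') c' 0 := by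
      simpa using ((hasDerivAt_id (0 : ℝ)).smul_const c').const_add (c t)
    have h2 : HasFDerivAt (fun u => F u x) (F' (c t) x) (c t + (0 : ℝ) • c') := by
      simpa using hder (c t) x
    have h3 := HasFDerivAt.comp_hasDerivAt (l := fun u => F u x) (0 : ℝ) h2 h1
    exact h3.unique (hG x)
  simp_rw [hGF] at hcomp
  exact hcomp

end ParametricIntegral

/-! ### Finite element functions depend smoothly on coefficients and position -/

section FEFunctions

variable {d N p : ℕ}

lemma contDiff_FE_fn_uncurry (i : Fin N) :
    ContDiff ℝ 1 fun z : FE d N p × Pt d => FE.fn z.1 i z.2 := by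
  unfold FE.fn
  refine ContDiff.sum fun α _ => ContDiff.mul ?_ (contDiff_prod fun k _ => ContDiff.pow ?_ _)
  · fun_prop
  · exact (EuclideanSpace.proj k : Pt d →L[ℝ] ℝ).contDiff.comp contDiff_snd

lemma contDiff_VFE_fn_uncurry (i : Fin N) :
    ContDiff ℝ 1 fun z : VFE d N p × Pt d => VFE.fn z.1 i z.2 := by
  rw [contDiff_euclidean]
  intro k
  exact (contDiff_FE_fn_uncurry i).comp
    (((contDiff_apply ℝ (FE d N p) k).comp contDiff_fst).prodMk contDiff_snd)

lemma contDiff_FE_fn (u : FE d N p) (i : Fin N) : ContDiff ℝ 1 (FE.fn u i) :=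
  (contDiff_FE_fn_uncurry i).comp (contDiff_const.prodMk contDiff_id)

lemma contDiff_VFE_fn (w : VFE d N p) (i : Fin N) : ContDiff ℝ 1 (VFE.fn w i) :=
  (contDiff_VFE_fn_uncurry i).comp (contDiff_const.prodMk contDiff_id)

lemma FE_fn_add (u u' : FE d N p) (i : Fin N) (x : Pt d) :
    FE.fn (u + u') i x = FE.fn u i x + FE.fn u' i x := by
  simp [FE.fn, add_mul, Finset.sum_add_distrib]

lemma FE_fn_smul (c : ℝ) (u : FE d N p) (i : Fin N) (x : Pt d) :
    FE.fn (c • u) i x = c * FE.fn u i x := by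
  simp [FE.fn, mul_assoc, Finset.mul_sum]

lemma VFE_fn_add (w w' : VFE d N p) (i : Fin N) (x : Pt d) :
    VFE.fn (w + w') i x = VFE.fn w i x + VFE.fn w' i x := by
  ext k
  simp [VFE.fn, FE_fn_add]

lemma VFE_fn_smul (c : ℝ) (w : VFE d N p) (i : Fin N) (x : Pt d) :
    VFE.fn (c • w) i x = c • VFE.fn w i x := by
  ext k
  simp [VFE.fn, FE_fn_smul]

lemma bgrad_FE_fn_add (u u' : FE d N p) (i : Fin N) (x : Pt d) :
    bgrad (FE.fn (u + u')) i x = bgrad (FE.fn u) i x + bgrad (FE.fn u') i x := by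
  have h : FE.fn (u + u') i = fun x => FE.fn u i x + FE.fn u' i x := funext (FE_fn_add u u' i)
  rw [bgrad, bgrad, bgrad, gradient, gradient, gradient, ← map_add, h, fderiv_fun_add
    ((contDiff_FE_fn u i).differentiable one_ne_zero x)
    ((contDiff_FE_fn u' i).differentiable one_ne_zero x)]

lemma bgrad_FE_fn_smul (c : ℝ) (u : FE d N p) (i : Fin N) (x : Pt d) :
    bgrad (FE.fn (c • u)) i x = c • bgrad (FE.fn u) i x := by
  have h : FE.fn (c • u) i = fun x => c * FE.fn u i x := funext (FE_fn_smul c u i)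
  rw [bgrad, bgrad, gradient, gradient, ← map_smul, h, fderiv_const_mul
    ((contDiff_FE_fn u i).differentiable one_ne_zero x)]

end FEFunctions

/-! ### The discrete gradient as a bilinear form -/

section BilinearLimit

lemma tendsto_bilinear {E F : Type*} [NormedAddCommGroup E] [NormedSpace ℝ E]
    [FiniteDimensional ℝ E] [NormedAddCommGroup F] [NormedSpace ℝ F] [FiniteDimensional ℝ F]
    (B : E →ₗ[ℝ] F →ₗ[ℝ] ℝ) {α : Type*} {l : Filter α} {f : α → E} {g : α → F} {x : E} {y : F}
    (hf : Filter.Tendsto f l (nhds x)) (hg : Filter.Tendsto g l (nhds y)) :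
    Filter.Tendsto (fun s => B (f s) (g s)) l (nhds (B x y)) := by
  have h : Continuous fun z : E × F => B.toContinuousBilinearMap z.1 z.2 := by fun_prop
  exact (h.tendsto (x, y)).comp (hf.prodMk_nhds hg)

end BilinearLimit

section GradForm

open Triangulation

variable {d N p : ℕ} [NeZero d] {Ω : Set (Pt d)} (M : Triangulation d Ω N)

/-- The bilinear form `gradForm` on the finite element spaces. -/
def gradBilin : FE d N p →ₗ[ℝ] VFE d N p →ₗ[ℝ] ℝ :=
  LinearMap.mk₂ ℝ (fun u w => gradForm M (FE.fn u) (VFE.fn w))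
    (fun u u' w => by
      have c1 := fun u : FE d N p => continuous_bgrad (contDiff_FE_fn u)
      have c2 := fun i => (contDiff_VFE_fn w i).continuous
      have c3 := fun (u : FE d N p) i => (contDiff_FE_fn u i).continuous
      have h1 := M.intDomain_add (fun i => (c1 u i).inner (c2 i)) (fun i => (c1 u' i).inner (c2 i))
      have h2 := M.intSkeleton_add (M.continuous_inner_jump_avg (c3 u) c2)
        (M.continuous_inner_jump_avg (c3 u') c2)
      simp only [gradForm]
      rw [sub_add_sub_comm, ← h1, ← h2]
      simp only [jump, FE_fn_add, bgrad_FE_fn_add, inner_add_left, inner_smul_left, add_mul,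
        RCLike.conj_to_real]
      congr 3
      ext e x
      ring)
    (fun c u w => by
      simp only [gradForm]
      rw [smul_eq_mul, mul_sub, ← M.intDomain_const_mul, ← M.intSkeleton_const_mul]
      simp only [jump, FE_fn_smul, bgrad_FE_fn_smul, inner_add_left, inner_smul_left,
        RCLike.conj_to_real]
      congr 2
      ext e x
      ring)
    (fun u w w' => by
      have c1 := continuous_bgrad (contDiff_FE_fn u)
      have c2 := fun (w : VFE d N p) i => (contDiff_VFE_fn w i).continuous
      have c3 := fun i => (contDiff_FE_fn u i).continuous
      have h1 := M.intDomain_add (fun i => (c1 i).inner (c2 w i)) (fun i => (c1 i).inner (c2 w' i))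
      have h2 := M.intSkeleton_add (M.continuous_inner_jump_avg c3 (c2 w))
        (M.continuous_inner_jump_avg c3 (c2 w'))
      simp only [gradForm]
      rw [sub_add_sub_comm, ← h1, ← h2]
      simp only [avg, VFE_fn_add, inner_add_right, inner_smul_right]
      congr 3
      ext e x
      ring)
    (fun c u w => by
      simp only [gradForm]
      rw [smul_eq_mul, mul_sub, ← M.intDomain_const_mul, ← M.intSkeleton_const_mul]
      simp only [avg, VFE_fn_smul, inner_add_right, inner_smul_right]
      congr 2
      ext e x
      ring)

lemma gradBilin_apply (u : FE d N p) (w : VFE d N p) :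
    gradBilin M u w = gradForm M (FE.fn u) (VFE.fn w) := rfl

end GradForm

/-! ### Time derivatives of the energy contributions -/

section EnergyDerivative

open Triangulation Topology Filter

variable {d N p : ℕ} [NeZero d] {Ω : Set (Pt d)} {M : Triangulation d Ω N} {P : Model}

omit [NeZero d] in
lemma measurableSet_elem_interior (i : Fin N) : MeasurableSet (M.elem i).interior := by
  by_cases hd : d = 0
  · subst hd
    exact (Set.subsingleton_of_subsingleton).measurableSet
  · have : NeZero d := ⟨hd⟩
    rw [simplex_interior_eq]
    exact isOpen_interior.measurableSet

lemma hasDerivAt_rho (s : ℝ) : HasDerivAt P.rho ((P.ρ₁ - P.ρ₂) / 2) s := by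
  have h := ((((hasDerivAt_id s).const_add 1).const_mul P.ρ₁).add
    (((hasDerivAt_id s).const_sub 1).const_mul P.ρ₂)).const_mul (1 / 2 : ℝ)
  have h' : HasDerivAt P.rho _ s := h
  exact h'.congr_deriv (by ring)

omit [NeZero d] in
/-- Time derivative of the potential and kinetic energy. -/
lemma hasDerivWithinAt_potential_kinetic {φ : ℝ → FE d N p} {v : ℝ → VFE d N p}
    {φ' : FE d N p} {v' : VFE d N p} {A : Set ℝ} {t : ℝ}
    (hφ : HasDerivWithinAt φ φ' A t) (hv : HasDerivWithinAt v v' A t) :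
    HasDerivWithinAt (fun s => M.intDomain fun i x =>
        P.W (FE.fn (φ s) i x) + 1 / 2 * P.rho (FE.fn (φ s) i x) * ‖VFE.fn (v s) i x‖ ^ 2)
      (M.intDomain (fun i x => deriv P.W (FE.fn (φ t) i x) * FE.fn φ' i x)
        + (P.ρ₁ - P.ρ₂) / 4 *
          M.intDomain (fun i x => ‖VFE.fn (v t) i x‖ ^ 2 * FE.fn φ' i x)
        + M.intDomain (fun i x => P.rho (FE.fn (φ t) i x) *
            inner ℝ (VFE.fn v' i x) (VFE.fn (v t) i x))) A t := by
  have cW : Continuous (deriv P.W) := P.W_contDiff.continuous_deriv le_rfl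
  have c1 := fun (u : FE d N p) i => (contDiff_FE_fn u i).continuous
  have c2 := fun (w : VFE d N p) i => (contDiff_VFE_fn w i).continuous
  have cWφ := fun i => cW.comp (c1 (φ t) i)
  have cρφ := fun i => (continuous_rho P).comp (c1 (φ t) i)
  simp only [Function.comp_def] at cWφ cρφ
  rw [← M.intDomain_const_mul, ← M.intDomain_add, ← M.intDomain_add]
  rotate_left
  all_goals try (intro i; have := cWφ i; have := cρφ i; fun_prop)
  refine HasDerivWithinAt.fun_sum fun i _ => ?_
  have hF : ContDiff ℝ 1 (Function.uncurry fun (z : FE d N p × VFE d N p) (x : Pt d) =>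
      P.W (FE.fn z.1 i x) + 1 / 2 * P.rho (FE.fn z.1 i x) * ‖VFE.fn z.2 i x‖ ^ 2) := by
    have h1 : ContDiff ℝ 1 fun y : (FE d N p × VFE d N p) × Pt d => FE.fn y.1.1 i y.2 :=
      (contDiff_FE_fn_uncurry i).comp
        ((contDiff_fst.comp contDiff_fst).prodMk contDiff_snd)
    have h2 : ContDiff ℝ 1 fun y : (FE d N p × VFE d N p) × Pt d => VFE.fn y.1.2 i y.2 :=
      (contDiff_VFE_fn_uncurry i).comp
        ((contDiff_snd.comp contDiff_fst).prodMk contDiff_snd)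
    have hρ : ContDiff ℝ 1 P.rho := by
      unfold Model.rho
      fun_prop
    exact (P.W_contDiff.comp h1).add
      ((contDiff_const.mul (hρ.comp h1)).mul (h2.norm_sq ℝ))
  refine hasDerivWithinAt_setIntegral hF (M.elem i).isCompact_closedInterior
    (M.elem i).interior_subset_closedInterior (measurableSet_elem_interior i)
    (hφ.prodMk hv) fun x => ?_
  have e1 : ∀ r : ℝ, FE.fn ((φ t, v t) + r • (φ', v')).1 i x
      = FE.fn (φ t) i x + r * FE.fn φ' i x := fun r => by
    rw [Prod.fst_add, Prod.smul_fst, FE_fn_add, FE_fn_smul]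
  have e2 : ∀ r : ℝ, VFE.fn ((φ t, v t) + r • (φ', v')).2 i x
      = VFE.fn (v t) i x + r • VFE.fn v' i x := fun r => by
    rw [Prod.snd_add, Prod.smul_snd, VFE_fn_add, VFE_fn_smul]
  simp only [e1, e2]
  have d1 : HasDerivAt (fun r : ℝ => FE.fn (φ t) i x + r * FE.fn φ' i x) (FE.fn φ' i x) 0 := by
    simpa using ((hasDerivAt_id (0 : ℝ)).mul_const (FE.fn φ' i x)).const_add (FE.fn (φ t) i x)
  have d2 : HasDerivAt (fun r : ℝ => VFE.fn (v t) i x + r • VFE.fn v' i x)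
      (VFE.fn v' i x) 0 := by
    simpa using ((hasDerivAt_id (0 : ℝ)).smul_const (VFE.fn v' i x)).const_add (VFE.fn (v t) i x)
  have dW : HasDerivAt P.W (deriv P.W (FE.fn (φ t) i x))
      (FE.fn (φ t) i x + 0 * FE.fn φ' i x) := by
    simpa using (P.W_contDiff.differentiable one_ne_zero (FE.fn (φ t) i x)).hasDerivAt
  have d3 := (dW.comp (0 : ℝ) d1).add
    ((((hasDerivAt_rho (P := P) _).comp (0 : ℝ) d1).const_mul (1 / 2)).mul d2.norm_sq)
  refine d3.congr_deriv ?_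
  simp only [Function.comp_apply, zero_mul, zero_smul, add_zero,
    real_inner_comm (VFE.fn v' i x)]
  ring

/-- Time derivative of the gradient energy. The field `q` is only assumed to be continuous;
its equation makes `‖q‖²` differentiable. -/
lemma hasDerivWithinAt_gradient_energy {φ : ℝ → FE d N p} {q : ℝ → VFE d N p}
    {φ' : FE d N p} {A : Set ℝ} {t : ℝ} (ht : t ∈ A)
    (hφ : HasDerivWithinAt φ φ' A t) (hq : ContinuousWithinAt q A t)
    (hmem : ∀ s ∈ A, q s ∈ feNormal M p)
    (h6 : ∀ s ∈ A, ∀ τ ∈ feNormal M p, Eq6 M (FE.fn (φ s)) (VFE.fn (q s)) (VFE.fn τ)) :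
    HasDerivWithinAt (fun s => M.intDomain fun i x => ‖VFE.fn (q s) i x‖ ^ 2)
      (2 * gradForm M (FE.fn φ') (VFE.fn (q t))) A t := by
  have c1 := fun (u : FE d N p) => continuous_bgrad (contDiff_FE_fn u)
  have c2 := fun (w : VFE d N p) i => (contDiff_VFE_fn w i).continuous
  have hform : ∀ s ∈ A, ∀ τ ∈ feNormal M p,
      M.intDomain (fun i x => inner ℝ (VFE.fn (q s) i x) (VFE.fn τ i x))
        = gradBilin M (φ s) τ := by
    intro s hs τ hτ
    have h := h6 s hs τ hτ
    rw [Eq6, M.intDomain_sub (fun i => (c2 (q s) i).inner (c2 τ i))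
      (fun i => (c1 (φ s) i).inner (c2 τ i))] at h
    rw [gradBilin_apply, gradForm]
    linarith
  have hadd : ∀ s ∈ A, q s + q t ∈ feNormal M p := by
    intro s hs f hf x hx
    rw [VFE_fn_add, inner_add_left, hmem s hs f hf x hx, hmem t ht f hf x hx, add_zero]
  -- Write the difference of squares as $(q(s)-q(t))\cdot(q(s)+q(t))$ and apply the sixth equation
  -- at both times with the same test function $q(s)+q(t)$.
  have hdiff : ∀ s ∈ A, (M.intDomain fun i x => ‖VFE.fn (q s) i x‖ ^ 2)
      - (M.intDomain fun i x => ‖VFE.fn (q t) i x‖ ^ 2)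
      = gradBilin M (φ s - φ t) (q s + q t) := by
    intro s hs
    rw [map_sub, LinearMap.sub_apply, ← hform s hs _ (hadd s hs), ← hform t ht _ (hadd s hs),
      ← M.intDomain_sub, ← M.intDomain_sub]
    · congr 1
      ext i x
      rw [VFE_fn_add, inner_add_right, inner_add_right, real_inner_self_eq_norm_sq,
        real_inner_self_eq_norm_sq, real_inner_comm (VFE.fn (q t) i x)]
      ring
    all_goals intro i; have := c2 (q s) i; have := c2 (q t) i; have := c2 (q s + q t) i; fun_prop
  rw [hasDerivWithinAt_iff_tendsto_slope] at hφ ⊢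
  -- Only $\phi$ enters through a difference quotient; for $q$ continuity is enough.
  have hlim : Tendsto (fun s => gradBilin M (slope φ t s) (q s + q t)) (𝓝[A \ {t}] t)
      (𝓝 (gradBilin M φ' (q t + q t))) := by
    have hq' : Tendsto (fun s => q s + q t) (𝓝[A \ {t}] t) (𝓝 (q t + q t)) :=
      (Tendsto.mono_left hq (nhdsWithin_mono t sdiff_subset)).add tendsto_const_nhds
    exact tendsto_bilinear (gradBilin M) hφ hq'
  have h2 : gradBilin M φ' (q t + q t) = 2 * gradForm M (FE.fn φ') (VFE.fn (q t)) := by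
    rw [map_add, ← two_mul, gradBilin_apply]
  rw [h2] at hlim
  refine hlim.congr' ?_
  filter_upwards [self_mem_nhdsWithin] with s hs
  rw [slope_def_module, slope_def_field, hdiff s hs.1, map_smul, LinearMap.smul_apply,
    smul_eq_mul, div_eq_inv_mul]

end EnergyDerivative

end QuasiIncompressible

end

/-! ### The dissipation equality -/

theorem mainTheorem2 (d N p : ℕ) [NeZero d] (hd : d ≤ 3)
    (Ω : Set (QuasiIncompressible.Pt d)) (hΩ : interior (closure Ω) = Ω)
    (M : QuasiIncompressible.Triangulation d Ω N) (P : QuasiIncompressible.Model) (T : ℝ)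
    (φ : ℝ → QuasiIncompressible.FE d N p) (v : ℝ → QuasiIncompressible.VFE d N p)
    (lam a b : ℝ → QuasiIncompressible.FE d N p) (q : ℝ → QuasiIncompressible.VFE d N p)
    (hsol : QuasiIncompressible.IsSemidiscreteSolution M P T φ v lam a b q) :
    ∀ t ∈ Set.Ico 0 T,
      HasDerivWithinAt
        (fun s => QuasiIncompressible.energy M P (QuasiIncompressible.FE.fn (φ s))
          (QuasiIncompressible.VFE.fn (v s)) (QuasiIncompressible.VFE.fn (q s)))
        (- M.intDomain (fun i x => P.m_r * |QuasiIncompressible.FE.fn (a t) i x| ^ 2)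
          + P.m_j * QuasiIncompressible.formA1 M P (QuasiIncompressible.FE.fn (a t))
              (QuasiIncompressible.FE.fn (a t))
          + P.η * QuasiIncompressible.formA2 M P (QuasiIncompressible.VFE.fn (v t))
              (QuasiIncompressible.VFE.fn (v t)))
        (Set.Ico 0 T) t := by
  open QuasiIncompressible in
  intro t ht
  have hφ := (hsol.phi_C1.differentiableOn one_ne_zero t ht).hasDerivWithinAt
  have hv := (hsol.v_C1.differentiableOn one_ne_zero t ht).hasDerivWithinAt
  set φ' := derivWithin φ (Set.Ico 0 T) t
  set v' := derivWithin v (Set.Ico 0 T) t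
  have h1 := hasDerivWithinAt_potential_kinetic (M := M) (P := P) hφ hv
  have h2 := (hasDerivWithinAt_gradient_energy (M := M) ht hφ (hsol.q_C0 t ht) hsol.q_mem
    hsol.eq6).const_mul (1 / 2 * P.γ)
  -- The time derivative of $\phi$ is again a coefficient vector in $\mathbb V$, hence an admissible
  -- test function in the fourth and fifth equations.
  have hbal := energy_balance (M := M) (P := P) hΩ (contDiff_FE_fn (φ t)) (contDiff_FE_fn φ')
    (contDiff_VFE_fn (v t)) (fun i => (contDiff_VFE_fn v' i).continuous)
    (contDiff_FE_fn (a t)) (contDiff_FE_fn (b t)) (fun i => (contDiff_FE_fn (lam t) i).continuous)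
    (contDiff_VFE_fn (q t)) (hsol.v_mem t ht) (hsol.q_mem t ht)
    (hsol.eq1 t ht (a t)) (hsol.eq2 t ht (v t) (hsol.v_mem t ht)) (hsol.eq3 t ht (b t))
    (hsol.eq4 t ht φ') (hsol.eq5 t ht φ')
  have henergy : ∀ s, energy M P (FE.fn (φ s)) (VFE.fn (v s)) (VFE.fn (q s))
      = M.intDomain (fun i x => P.W (FE.fn (φ s) i x)
          + 1 / 2 * P.rho (FE.fn (φ s) i x) * ‖VFE.fn (v s) i x‖ ^ 2)
        + 1 / 2 * P.γ * M.intDomain (fun i x => ‖VFE.fn (q s) i x‖ ^ 2) := by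
    intro s
    have c1 := fun i => P.W_contDiff.continuous.comp (contDiff_FE_fn (φ s) i).continuous
    have c2 := fun i => (continuous_rho P).comp (contDiff_FE_fn (φ s) i).continuous
    have c3 := fun i => (contDiff_VFE_fn (v s) i).continuous
    have c4 := fun i => (contDiff_VFE_fn (q s) i).continuous
    rw [← M.intDomain_const_mul, ← M.intDomain_add]
    · rfl
    · exact fun i => (c1 i).add ((continuous_const.mul (c2 i)).mul ((c3 i).norm.pow 2))
    · exact fun i => continuous_const.mul ((c4 i).norm.pow 2)
  have hsq : M.intDomain (fun i x => P.m_r * |FE.fn (a t) i x| ^ 2)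
      = P.m_r * M.intDomain (fun i x => FE.fn (a t) i x * FE.fn (a t) i x) := by
    rw [← M.intDomain_const_mul]
    simp only [sq_abs]
    simp only [sq]
  simp_rw [henergy]
  refine (h1.add h2).congr_deriv ?_
  rw [hsq, ← hbal]
  ring
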